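/- Let $n\ge 1$ and $1\le r\le n$ be integers, and let $q$ be a prime power or $q=1$. *Matroids.* For a prime power $q$, $U_{r,n}(q)$ is the matroid whose ground set is the set of nonzero vectors of $\mathbb{F}_q^n$ and whose flats are the sets $V\setminus\{0\}$, where $V$ is a subspace of $\mathbb{F}_q^n$ with $\dim V\le r-1$ or $V=\mathbb{F}_q^n$. For $q=1$, $U_{r,n}(1)=U_{r,n}$ is the uniform matroid on $[n]=\{1,\dots,n\}$, whose flats are the subsets with at most $r-1$ elements and $[n]$. *Chow rings.* For a loopless matroid $M$ on $E$ with set of flats $\mathcal{L}(M)$, the Chow ring is $$A(M)=\mathbb{Q}[x_F: F\in\mathcal{L}(M)\setminus\{\emptyset\}]\Big/\Big(\langle x_Fx_{F'}: F,F'\text{ incomparable}\rangle+\Big\langle \sum_{F\ni i}x_F : i\in E\Big\rangle\Big),$$ and the augmented Chow ring $\widetilde{A}(M)$ is the quotient of $\mathbb{Q}[\{x_F\}_{F\in\mathcal{L}(M)\setminus\{E\}}\cup\{y_i\}_{i\in E}]$ by the ideal generated by $x_Fx_{F'}$ for incomparable proper flats $F,F'$, by $y_ix_F$ for $i\in E$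 and proper flats $F\not\ni i$, and by $y_i-\sum_{F\not\ni i}x_F$ for $i\in E$. Both are graded with all variables in degree $1$, with finite-dimensional components, and $\mathsf{Hilb}(B,t)=\sum_{j\ge 0}\dim_{\mathbb{Q}}(B^j)\,t^j$. If $\mathsf{Hilb}(B,t)$ is a polynomial of degree $d$, the Charney–Davis quantity is $CD(B)=(-1)^{d/2}\mathsf{Hilb}(B,-1)$ for $d$ even and $CD(B)=\mathsf{Hilb}(B,-1)$ for $d$ odd. *Permutations.* For $\sigma\in\mathfrak{S}_n$ let $\mathsf{DES}(\sigma)=\{i\in[n-1]:\sigma_i>\sigma_{i+1}\}$ and $\mathsf{inv}(\sigma)=|\{(i,j): i<j,\ \sigma_i>\sigma_j\}|$. For $k$ even let $\mathsf{Even}(k)=\{2,4,\dots,k\}$, and for $k$ odd let $\mathsf{Odd}(k)=\{1,3,\dots,k\}$ (so $\mathsf{Even}(0)=\emptyset$). **Theorem.** The Hilbert series of $A(U_{r,n}(q))$ and $\widetilde{A}(U_{r,n}(q))$ are polynomials in $t$, and the following hold. (i) $$\mathsf{Hilb}(A(U_{r,n}(q)),-1)=\begin{cases}0 & \text{if } r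 \text{ is even},\\ (-1)^{\frac{r-1}{2}}\displaystyle\sum_{\substack{\sigma\in\mathfrak{S}_n\\ \mathsf{DES}(\sigma)=\mathsf{Even}(r-1)}}q^{\mathsf{inv}(\sigma)} & \text{if } r\text{ is odd}.\end{cases}$$ (ii) $$\mathsf{Hilb}(\widetilde{A}(U_{r,n}(q)),-1)=\begin{cases}(-1)^{\frac{r}{2}}\displaystyle\sum_{\substack{\sigma\in\mathfrak{S}_n\\ \mathsf{DES}(\sigma)=\mathsf{Odd}(r-1)}}q^{\mathsf{inv}(\sigma)} & \text{if } r \text{ is even},\\ 0 & \text{if } r\text{ is odd}.\end{cases}$$ In particular, $CD(A(U_{r,n}(q)))$ and $CD(\widetilde{A}(U_{r,n}(q)))$ are polynomials in $q$ with nonnegative integer coefficients: there are $P,Q\in\mathbb{Z}_{\ge0}[x]$, depending only on $n$ and $r$, such that $CD(A(U_{r,n}(q)))=P(q)$ and $CD(\widetilde{A}(U_{r,n}(q)))=Q(q)$ for $q=1$ and for every prime power $q$. -/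

import Mathlib

open Polynomial

noncomputable section

namespace MatroidChow

/-! ### Uniform matroids and `q`-uniform matroids -/

/-- The uniform matroid of rank `r` on an `n`-element ground set: a set is independent when it has
at most `r` elements. -/
def uniformMatroid (r n : ℕ) : Matroid (Fin n) :=
  (IndepMatroid.ofFinite (E := Set.univ) Set.finite_univ (fun I => I.ncard ≤ r)
    (by simp)
    (fun _ J hJ hIJ => (Set.ncard_le_ncard hIJ J.toFinite).trans hJ)
    (fun I J _ hJ hIJ => by
      obtain ⟨e, heJ, heI⟩ := Set.exists_mem_notMem_of_ncard_lt_ncard hIJ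
      refine ⟨e, heJ, heI, ?_⟩
      rw [Set.ncard_insert_of_notMem heI]
      omega)
    (fun _ _ => Set.subset_univ _)).matroid

theorem finrank_span_eq_ncard {n : ℕ} {K : Type*} [Field K] [Finite K] (I : Set (Fin n → K))
    (hI : LinearIndepOn K id I) : Module.finrank K (Submodule.span K I) = I.ncard := by
  have : Fintype I := Fintype.ofFinite I
  rw [Set.ncard_eq_toFinset_card', finrank_span_set_eq_card (R := K) (s := I) hI]

/-- The `q`-uniform matroid of rank `r` on the vector space `K ^ n`, where `K` is a finite field
with `q` elements. Its ground set consists of the nonzero vectors (the zero vector would be a loop),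
and a set is independent when it is linearly independent over `K` and has at most `r` elements. -/
def qUniformMatroid (r n : ℕ) (K : Type*) [Field K] [Finite K] : Matroid (Fin n → K) :=
  (IndepMatroid.ofFinite (E := {v : Fin n → K | v ≠ 0}) (Set.toFinite _)
    (fun I => LinearIndepOn K id I ∧ I.ncard ≤ r)
    ⟨linearIndepOn_empty K id, by simp⟩
    (fun _ J hJ hIJ => ⟨hJ.1.mono hIJ, (Set.ncard_le_ncard hIJ J.toFinite).trans hJ.2⟩)
    (fun I J hI hJ hIJ => by
      have hne : ¬ J ⊆ (Submodule.span K I : Set (Fin n → K)) := fun hsub => by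
        have h1 : Submodule.span K J ≤ Submodule.span K I := Submodule.span_le.2 hsub
        have h2 := Submodule.finrank_mono h1
        rw [finrank_span_eq_ncard J hJ.1, finrank_span_eq_ncard I hI.1] at h2
        omega
      obtain ⟨e, heJ, heI⟩ := Set.not_subset.1 hne
      have heI' : e ∉ I := fun h => heI (Submodule.subset_span h)
      refine ⟨e, heJ, heI', hI.1.id_insert heI, ?_⟩
      rw [Set.ncard_insert_of_notMem heI']
      omega)
    (fun I hI v hv h0 => hI.1.ne_zero hv h0)).matroid

theorem uniformMatroid_indep_iff (r n : ℕ) (I : Set (Fin n)) :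
    (uniformMatroid r n).Indep I ↔ I.ncard ≤ r := Iff.rfl

theorem qUniformMatroid_indep_iff (r n : ℕ) (K : Type*) [Field K] [Finite K]
    (I : Set (Fin n → K)) :
    (qUniformMatroid r n K).Indep I ↔ LinearIndepOn K id I ∧ I.ncard ≤ r := Iff.rfl

theorem isFlat_iff_of_isBasis {α : Type*} {M : Matroid α} {I F : Set α} (hI : M.IsBasis I F) :
    M.IsFlat F ↔ ∀ e ∈ M.E, e ∉ F → M.Indep (insert e I) := by
  rw [Matroid.isFlat_iff_closure_eq, ← hI.closure_eq_closure]
  constructor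
  · intro h e heE heF
    have heI : e ∉ I := fun h' => heF (hI.subset h')
    by_contra hcon
    have hd : M.Dep (insert e I) := ⟨hcon, Set.insert_subset heE hI.indep.subset_ground⟩
    have := (hI.indep.mem_closure_iff_of_notMem heI).2 hd
    exact heF (h ▸ this)
  · intro h
    refine Set.Subset.antisymm (fun e he => ?_) hI.subset_closure
    by_contra heF
    have heI : e ∉ I := fun h' => heF (hI.subset h')
    have hd := (hI.indep.mem_closure_iff_of_notMem heI).1 he
    exact hd.1 (h e (M.closure_subset_ground I he) heF)

/-- The flats of the uniform matroid are the sets with fewer than `r` elements and the whole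
ground set. -/
theorem uniformMatroid_isFlat_iff (r n : ℕ) (F : Set (Fin n)) :
    (uniformMatroid r n).IsFlat F ↔ F.ncard < r ∨ F = Set.univ := by
  obtain ⟨I, hI⟩ := (uniformMatroid r n).exists_isBasis F (Set.subset_univ F)
  rw [isFlat_iff_of_isBasis hI]
  have hmax : ∀ e ∈ F, e ∉ I → ¬ (insert e I).ncard ≤ r := fun e heF heI h =>
    heI (hI.mem_of_insert_indep heF h)
  have hIr : I.ncard ≤ r := hI.indep
  constructor
  · intro h
    by_contra! hcon
    obtain ⟨e, he⟩ := (Set.ne_univ_iff_exists_notMem F).1 hcon.2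
    have heI : e ∉ I := fun h' => he (hI.subset h')
    have h1 : (insert e I).ncard ≤ r := h e (Set.mem_univ e) he
    rw [Set.ncard_insert_of_notMem heI] at h1
    obtain ⟨f, hfF, hfI⟩ := Set.exists_mem_notMem_of_ncard_lt_ncard (s := I) (t := F) (by omega)
    apply hmax f hfF hfI
    rw [Set.ncard_insert_of_notMem hfI]
    exact h1
  · rintro (h | rfl) e - he
    · have h1 := Set.ncard_le_ncard hI.subset F.toFinite
      have h2 := Set.ncard_insert_le e I
      exact (uniformMatroid_indep_iff r n _).2 (by omega)
    · exact absurd (Set.mem_univ e) he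

/-- The flats of the `q`-uniform matroid are the subspaces of dimension less than `r` and the whole
space (each with its zero vector removed). -/
theorem qUniformMatroid_isFlat_iff (r n : ℕ) (K : Type*) [Field K] [Finite K]
    (F : Set (Fin n → K)) :
    (qUniformMatroid r n K).IsFlat F ↔
      ∃ V : Submodule K (Fin n → K), (Module.finrank K V < r ∨ V = ⊤) ∧
        F = {v | v ∈ V ∧ v ≠ 0} := by
  constructor
  · intro hF
    obtain ⟨I, hI⟩ := (qUniformMatroid r n K).exists_isBasis F hF.subset_ground
    by_cases hFE : F = {v | v ≠ 0}
    · exact ⟨⊤, Or.inr rfl, by simpa using hFE⟩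
    have h := (isFlat_iff_of_isBasis hI).1 hF
    have hlt : I.ncard < r := by
      obtain ⟨e, heE, heF⟩ := Set.exists_of_ssubset (hF.subset_ground.ssubset_of_ne hFE)
      have heI : e ∉ I := fun h' => heF (hI.subset h')
      have h1 := (h e heE heF).2
      rw [Set.ncard_insert_of_notMem heI] at h1
      omega
    refine ⟨Submodule.span K I, Or.inl ?_, ?_⟩
    · rwa [finrank_span_eq_ncard I hI.indep.1]
    · ext v
      constructor
      · intro hv
        refine ⟨?_, hF.subset_ground hv⟩
        by_contra hvs
        have hvI : v ∉ I := fun h' => hvs (Submodule.subset_span h')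
        refine hvI (hI.mem_of_insert_indep hv ⟨hI.indep.1.id_insert hvs, ?_⟩)
        rw [Set.ncard_insert_of_notMem hvI]
        omega
      · rintro ⟨hv, hv0⟩
        by_contra hvF
        have hvI : v ∉ I := fun h' => hvF (hI.subset h')
        exact ((linearIndepOn_id_insert hvI).1 (h v hv0 hvF).1).2 hv
  · rintro ⟨V, hV | rfl, rfl⟩
    · have hFE : {v | v ∈ V ∧ v ≠ 0} ⊆ (qUniformMatroid r n K).E := fun v hv => hv.2
      obtain ⟨I, hI⟩ := (qUniformMatroid r n K).exists_isBasis _ hFE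
      rw [isFlat_iff_of_isBasis hI]
      have hIV : Submodule.span K I ≤ V := Submodule.span_le.2 fun v hv => (hI.subset hv).1
      have hcard : I.ncard < r := by
        have := Submodule.finrank_mono hIV
        rw [finrank_span_eq_ncard I hI.indep.1] at this
        omega
      intro e heE heF
      have heV : e ∉ V := fun h' => heF ⟨h', heE⟩
      have heI : e ∉ I := fun h' => heF (hI.subset h')
      refine ⟨hI.indep.1.id_insert fun h' => heV (hIV h'), ?_⟩
      rw [Set.ncard_insert_of_notMem heI]
      omega
    · have := (qUniformMatroid r n K).ground_isFlat
      convert this using 1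
      ext v
      change (v ∈ (⊤ : Submodule K (Fin n → K)) ∧ v ≠ 0) ↔ v ≠ 0
      simp

/-! ### Chow rings -/

section Chow

variable {α : Type*}

/-- The index set of the variables of the Chow ring: the nonempty flats. -/
abbrev NonemptyFlat (M : Matroid α) : Type _ := {F : Set α // M.IsFlat F ∧ F.Nonempty}

/-- The index set of the variables `x_F` of the augmented Chow ring: the proper flats, that is,
the flats other than the ground set. The empty flat is included. -/
abbrev ProperFlat (M : Matroid α) : Type _ := {F : Set α // M.IsFlat F ∧ F ≠ M.E}

/-- Two sets are incomparable when neither is contained in the other. -/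
def Incomparable (F G : Set α) : Prop := ¬ F ⊆ G ∧ ¬ G ⊆ F

open Classical in
/-- The ideal of relations of the Chow ring of a loopless matroid: `x_F * x_G` for incomparable
flats `F` and `G`, and the sum of the `x_F` over the flats `F` containing `i`, for each `i` in the
ground set. -/
def chowIdeal [Fintype α] (M : Matroid α) : Ideal (MvPolynomial (NonemptyFlat M) ℚ) :=
  Ideal.span {p | ∃ F G : NonemptyFlat M, Incomparable F.1 G.1 ∧
      p = MvPolynomial.X F * MvPolynomial.X G} ⊔
  Ideal.span {p | ∃ i ∈ M.E, p = ∑ F : NonemptyFlat M with i ∈ F.1, MvPolynomial.X F}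

/-- The Chow ring of a loopless matroid, with its maximal building set presentation. -/
abbrev ChowRing [Fintype α] (M : Matroid α) : Type _ :=
  MvPolynomial (NonemptyFlat M) ℚ ⧸ chowIdeal M

/-- The homogeneous component of degree `j` of the Chow ring: the classes of the homogeneous
polynomials of degree `j`. -/
def chowComponent [Fintype α] (M : Matroid α) (j : ℕ) : Submodule ℚ (ChowRing M) :=
  (MvPolynomial.homogeneousSubmodule (NonemptyFlat M) ℚ j).map
    (Ideal.Quotient.mkₐ ℚ (chowIdeal M)).toLinearMap

/-- The variables of the augmented Chow ring: `x_F` for proper flats `F` (`Sum.inl F`) and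
`y_i` for elements `i` of the ground set (`Sum.inr i`). -/
abbrev AugVar (M : Matroid α) : Type _ := ProperFlat M ⊕ M.E

open Classical in
/-- The ideal of relations of the augmented Chow ring of a loopless matroid: `x_F * x_G` for
incomparable proper flats `F` and `G`, `y_i * x_F` for `i` not in `F`, and
`y_i` minus the sum of the `x_F` over the proper flats `F` not containing `i`. -/
def augChowIdeal [Fintype α] (M : Matroid α) : Ideal (MvPolynomial (AugVar M) ℚ) :=
  Ideal.span {p | ∃ F G : ProperFlat M, Incomparable F.1 G.1 ∧
      p = MvPolynomial.X (Sum.inl F) * MvPolynomial.X (Sum.inl G)} ⊔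
  Ideal.span {p | ∃ (i : M.E) (F : ProperFlat M), i.1 ∉ F.1 ∧
      p = MvPolynomial.X (Sum.inr i) * MvPolynomial.X (Sum.inl F)} ⊔
  Ideal.span {p | ∃ i : M.E, p = MvPolynomial.X (Sum.inr i) -
      ∑ F : ProperFlat M with i.1 ∉ F.1, MvPolynomial.X (Sum.inl F)}

/-- The augmented Chow ring of a loopless matroid. -/
abbrev AugChowRing [Fintype α] (M : Matroid α) : Type _ :=
  MvPolynomial (AugVar M) ℚ ⧸ augChowIdeal M

/-- The homogeneous component of degree `j` of the augmented Chow ring. -/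
def augChowComponent [Fintype α] (M : Matroid α) (j : ℕ) : Submodule ℚ (AugChowRing M) :=
  (MvPolynomial.homogeneousSubmodule (AugVar M) ℚ j).map
    (Ideal.Quotient.mkₐ ℚ (augChowIdeal M)).toLinearMap

theorem chowComponent_finite [Fintype α] (M : Matroid α) (j : ℕ) :
    Module.Finite ℚ (chowComponent M j) :=
  Module.Finite.iff_fg.2 ((MvPolynomial.homogeneousSubmodule_fg _ _ j).map _)

theorem augChowComponent_finite [Fintype α] (M : Matroid α) (j : ℕ) :
    Module.Finite ℚ (augChowComponent M j) :=
  Module.Finite.iff_fg.2 ((MvPolynomial.homogeneousSubmodule_fg _ _ j).map _)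

end Chow

/-! ### Hilbert series and Charney--Davis quantities -/

/-- The Hilbert series of a graded vector space with finite-dimensional components `𝒜 j`. -/
def hilbertSeries {A : Type*} [AddCommGroup A] [Module ℚ A] (𝒜 : ℕ → Submodule ℚ A) :
    PowerSeries ℤ :=
  PowerSeries.mk fun j => (Module.finrank ℚ (𝒜 j) : ℤ)

/-- The Charney--Davis quantity of a graded algebra whose Hilbert series is the polynomial `H`:
with `d` the degree of `H`, it is `(-1) ^ (d / 2) * H(-1)` if `d` is even and `H(-1)` if `d` is
odd. -/
def charneyDavis (H : ℤ[X]) : ℤ :=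
  if Even H.natDegree then (-1) ^ (H.natDegree / 2) * H.eval (-1) else H.eval (-1)

/-! ### Permutation statistics -/

/-- The descent set `{i ∈ [n - 1] | σ_i > σ_{i+1}}` of a permutation; positions are numbered from
`1`, so the element `i` of `Fin n` stands for position `i + 1`. -/
def descentSet {n : ℕ} (σ : Equiv.Perm (Fin n)) : Finset ℕ :=
  (Finset.univ.filter fun i : Fin n => ∃ h : i.1 + 1 < n, σ ⟨i.1 + 1, h⟩ < σ i).image
    fun i => i.1 + 1

/-- The number of inversions of a permutation. -/
def inversionNumber {n : ℕ} (σ : Equiv.Perm (Fin n)) : ℕ :=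
  (Finset.univ.filter fun p : Fin n × Fin n => p.1 < p.2 ∧ σ p.2 < σ p.1).card

/-- `{2, 4, 6, …, k}`, the set of even numbers from `2` up to `k`. -/
def evenSet (k : ℕ) : Finset ℕ := (Finset.Icc 1 k).filter Even

/-- `{1, 3, 5, …, k}`, the set of odd numbers from `1` up to `k`. -/
def oddSet (k : ℕ) : Finset ℕ := (Finset.Icc 1 k).filter Odd

end MatroidChow

end

open MatroidChow

/-!
The Hilbert polynomial of a Chow ring can be computed by adjoining the variables `x_F` one at a
time, the minimal flats last. In geometric terms each step is a blowup: a new variable `x` is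
adjoined to a graded ring `A` under the relations `x J = 0` and `(x + s) ^ c = 0`, where `A ⧸ J` is
the ring of the centre. If `s ^ c J = 0`, the new ring is `A ⊕ x (A ⧸ J) ⊕ ⋯ ⊕ x ^ (c - 1) (A ⧸ J)`
(`HasHilb.adjoin`). The ideals that occur are those of `chainIdeal`, in which the linear relations
of the Chow ring are replaced by the power relations of Feichtner and Yuzvinsky; the ring of the
centre belongs to the interval above the new flat (`HasHilb.insert`). So the Hilbert polynomials
`H_F` of the intervals above flats satisfy
`H_F = 1 + ∑_{G > F} (t + ⋯ + t ^ (rk G - rk F - 1)) H_G`.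

The augmented Chow ring fits in the same frame: after elimination of the `y_i`, and with a variable
for the ground set defined as minus the sum of all others, it is the ring of all flats, the empty
one included, with ranks raised by one (`hasHilb_augChowIdeal`).

In the uniform and `q`-uniform matroids, the interval above a flat of rank `k` has as many flats of
rank `j < r` as the Gaussian binomial coefficient of `n - k` and `j - k` says (`HasUniformFlats`),
and the recursion runs over ranks only (`chowPoly`, `augChowPoly`). At `t = -1` the factor
`t + ⋯ + t ^ m` is `0` for even `m` and `-1` for odd `m`. This kills every other term, and what
remains is an alternating convolution with Gaussian binomial coefficients (`eval_chowPoly`,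
`eval_augChowPoly`).

The generating functions by inversions of the permutations with descent sets `{2, 4, …}` and
`{1, 3, …}` solve this convolution. A permutation with no descent before `j` is a shuffle of an
increasing word of length `j` and an arbitrary permutation, and the inversions between the two
parts are counted by a Gaussian binomial coefficient (`gaussBinom_mul_descentGF`). Whether there is
a descent at `j` is free, so each term of the convolution is a sum of two consecutive terms of a
sequence, and the alternating sum telescopes (`sum_gaussBinom_evenSet`, `sum_gaussBinom_oddSet`).
-/

noncomputable section

namespace MatroidChow

/-! ### Adjoining a variable to a graded quotient, as for the ring of a blowup -/

/-- `HasHilb I H` says that the quotient of the polynomial ring by `I` has a finite `ℚ`-basis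
consisting of classes of homogeneous polynomials `b i` of degree `d i`, and that `H` is the
generating polynomial `∑ i, t ^ d i` of the degrees. -/
def HasHilb {σ : Type*} (I : Ideal (MvPolynomial σ ℚ)) (H : ℤ[X]) : Prop :=
  ∃ (ι : Type) (_ : Fintype ι) (b : ι → MvPolynomial σ ℚ) (d : ι → ℕ),
    (∀ i, (b i).IsHomogeneous (d i)) ∧
    (∀ α : ι → ℚ, ∑ i, α i • b i ∈ I → ∀ i, α i = 0) ∧
    (∀ p, ∃ α : ι → ℚ, p - ∑ i, α i • b i ∈ I) ∧
    H = ∑ i, X ^ d i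

/-- The polynomial `t + t ^ 2 + ⋯ + t ^ m`. -/
def geomPoly (m : ℕ) : ℤ[X] := ∑ a ∈ Finset.range m, X ^ (a + 1)

section Blowup

variable {A : Type*} [CommRing A]

/-- The ideal `(x J, (x + s) ^ c)` of `A[x]`, by which one divides to pass from the cohomology ring
`A` of a variety to that of the blowup of a centre with ring `A ⧸ J`. -/
def blowupIdeal (J : Ideal A) (s : A) (c : ℕ) : Ideal A[X] :=
  Ideal.span {X} * J.map C ⊔ Ideal.span {(X + C s) ^ c}

/-- A polynomial of degree less than `c` in the blowup ideal lies in `x J[x]`. -/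
theorem coeff_of_mem_blowupIdeal {J : Ideal A} {s : A} {c : ℕ} (hs : ∀ a ∈ J, s ^ c * a = 0)
    {f : A[X]} (hf : f ∈ blowupIdeal J s c) (hdeg : f.degree < c) :
    f.coeff 0 = 0 ∧ ∀ a, f.coeff a ∈ J := by
  obtain ⟨y, hy, z, hz, rfl⟩ := Submodule.mem_sup.1 hf
  obtain ⟨u, hu, rfl⟩ := Ideal.mem_span_singleton_mul.1 hy
  obtain ⟨g, rfl⟩ := Ideal.mem_span_singleton'.1 hz
  rw [Ideal.mem_map_C_iff] at hu
  set f := X * u + g * (X + C s) ^ c with hfdef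
  have hu0 : u.map (Ideal.Quotient.mk J) = 0 := by
    ext i
    simpa [Ideal.Quotient.eq_zero_iff_mem] using hu i
  have hfm : f.map (Ideal.Quotient.mk J) =
      (X + C (Ideal.Quotient.mk J s)) ^ c * g.map (Ideal.Quotient.mk J) := by
    simp [hfdef, hu0, mul_comm]
  have hf0 : f.map (Ideal.Quotient.mk J) = 0 := by
    rcases subsingleton_or_nontrivial (A ⧸ J) with h | h
    · exact Subsingleton.elim _ _
    by_contra hne
    have hmon : ((X + C (Ideal.Quotient.mk J s)) ^ c).Monic := (monic_X_add_C _).pow c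
    refine hmon.not_dvd_of_degree_lt hne ?_ ⟨_, hfm⟩
    rw [degree_eq_natDegree hmon.ne_zero, (monic_X_add_C _).natDegree_pow, natDegree_X_add_C,
      mul_one]
    exact degree_map_le.trans_lt hdeg
  have hg0 : g.map (Ideal.Quotient.mk J) = 0 := by
    have hmon : ((X + C (Ideal.Quotient.mk J s)) ^ c).Monic := (monic_X_add_C _).pow c
    rw [hf0, eq_comm] at hfm
    exact (hmon.mul_right_eq_zero_iff).1 hfm
  constructor
  · have : g.coeff 0 ∈ J := by
      rw [← Ideal.Quotient.eq_zero_iff_mem, ← coeff_map, hg0, coeff_zero]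
    have h2 := hs _ this
    simp [hfdef, coeff_zero_eq_eval_zero] at h2 ⊢
    linear_combination h2
  · intro a
    rw [← Ideal.Quotient.eq_zero_iff_mem, ← coeff_map, hf0, coeff_zero]

end Blowup

section Step

variable {σ : Type*}

open Classical in
/-- The endomorphism of a polynomial ring that sets the variable `g` to zero. -/
def killVar (g : σ) : MvPolynomial σ ℚ →ₐ[ℚ] MvPolynomial σ ℚ :=
  MvPolynomial.aeval fun k => if k = g then 0 else MvPolynomial.X k

open Classical in
/-- The map that reads a polynomial as a polynomial in the variable `g`, whose coefficients are
taken modulo `I`. -/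
def splitVar (g : σ) (I : Ideal (MvPolynomial σ ℚ)) :
    MvPolynomial σ ℚ →ₐ[ℚ] (MvPolynomial σ ℚ ⧸ I)[X] :=
  MvPolynomial.aeval fun k => if k = g then X else C (Ideal.Quotient.mk I (MvPolynomial.X k))

theorem killVar_X_self (g : σ) : killVar g (MvPolynomial.X g) = 0 := by simp [killVar]

theorem killVar_X_of_ne {g k : σ} (h : k ≠ g) :
    killVar g (MvPolynomial.X k) = MvPolynomial.X k := by
  simp [killVar, h]

theorem splitVar_X_self (g : σ) (I : Ideal (MvPolynomial σ ℚ)) :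
    splitVar g I (MvPolynomial.X g) = X := by simp [splitVar]

theorem splitVar_X_of_ne {g k : σ} (I : Ideal (MvPolynomial σ ℚ)) (h : k ≠ g) :
    splitVar g I (MvPolynomial.X k) = C (Ideal.Quotient.mk I (MvPolynomial.X k)) := by
  simp [splitVar, h]

theorem killVar_isHomogeneous (g : σ) {p : MvPolynomial σ ℚ} {m : ℕ} (hp : p.IsHomogeneous m) :
    (killVar g p).IsHomogeneous m := by
  classical
  have := hp.aeval (fun k => if k = g then (0 : MvPolynomial σ ℚ) else MvPolynomial.X k) (n := 1)
    (fun k => by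
    split_ifs
    · exact MvPolynomial.isHomogeneous_zero _ _ _
    · exact MvPolynomial.isHomogeneous_X _ _)
  rw [one_mul] at this
  exact this

theorem splitVar_killVar {g : σ} {I : Ideal (MvPolynomial σ ℚ)} (hg : MvPolynomial.X g ∈ I)
    (p : MvPolynomial σ ℚ) : splitVar g I (killVar g p) = C (Ideal.Quotient.mk I p) := by
  have : (splitVar g I).comp (killVar g) =
      (CAlgHom (R := ℚ) (A := MvPolynomial σ ℚ ⧸ I)).comp (Ideal.Quotient.mkₐ ℚ I) := by
    apply MvPolynomial.algHom_ext
    intro k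
    by_cases h : k = g
    · subst h
      simp [killVar_X_self, Ideal.Quotient.eq_zero_iff_mem.2 hg]
    · simp [killVar_X_of_ne h, splitVar_X_of_ne I h]
  exact DFunLike.congr_fun this p

/-- The additive form of the blowup formula. Let `N` be the ideal obtained from `I` by freeing the
variable `x = X g`, which `I` kills, under the relations `x * I'` and `(x + s) ^ c`. If `s ^ c`
kills `I' / I`, then dividing with remainder by the monic polynomial `(x + s) ^ c` shows that the
quotient by `N` is the direct sum of the quotient by `I` and of the multiples of
`x, …, x ^ (c - 1)` with coefficients in the quotient by `I'`.

The relations of `N` enter only through what is used of them: `hI`, `hI'` and `hx` bound `N` from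
below, and `hN` bounds it from above. -/
theorem HasHilb.adjoin {g : σ} {I I' N : Ideal (MvPolynomial σ ℚ)} {s : MvPolynomial σ ℚ} {c : ℕ}
    {H H' : ℤ[X]} (hc : 1 ≤ c) (hII' : I ≤ I') (hg : MvPolynomial.X g ∈ I)
    (hs : ∀ a ∈ I', s ^ c * a ∈ I)
    (hI : ∀ a ∈ I, killVar g a ∈ N) (hI' : ∀ a ∈ I', MvPolynomial.X g * killVar g a ∈ N)
    (hx : (MvPolynomial.X g + killVar g s) ^ c ∈ N)
    (hN : ∀ a ∈ N, splitVar g I a ∈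
      blowupIdeal (I'.map (Ideal.Quotient.mk I)) (Ideal.Quotient.mk I s) c)
    (h : HasHilb I H) (h' : HasHilb I' H') : HasHilb N (H + geomPoly (c - 1) * H') := by
  obtain ⟨ι, _, b, d, hbd, hbl, hbs, rfl⟩ := h
  obtain ⟨κ, _, e, d', hed, hel, hes, rfl⟩ := h'
  refine ⟨ι ⊕ (Fin (c - 1) × κ), inferInstance,
    Sum.elim (fun i => killVar g (b i))
      (fun x => MvPolynomial.X g ^ (x.1.1 + 1) * killVar g (e x.2)),
    Sum.elim d (fun x => x.1.1 + 1 + d' x.2), ?_, ?_, ?_, ?_⟩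
  · rintro (i | ⟨a, k⟩)
    · exact killVar_isHomogeneous g (hbd i)
    · exact ((MvPolynomial.isHomogeneous_X_pow g _)).mul (killVar_isHomogeneous g (hed k))
  -- linear independence: read a relation as a polynomial in `x` of degree less than `c`
  · intro α hα
    have hα' := hN _ hα
    set f := splitVar g I (∑ i, α i • Sum.elim (fun i => killVar g (b i))
      (fun x : Fin (c - 1) × κ => MvPolynomial.X g ^ (x.1.1 + 1) * killVar g (e x.2)) i) with hfdef
    have hC : ∀ (r : ℚ) (p : MvPolynomial σ ℚ), C (Ideal.Quotient.mk I (r • p)) =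
        r • C (Ideal.Quotient.mk I p) :=
      ((CAlgHom (R := ℚ)).comp (Ideal.Quotient.mkₐ ℚ I)).toLinearMap.map_smul
    have hf : f = C (Ideal.Quotient.mk I (∑ i, α (Sum.inl i) • b i)) + ∑ a : Fin (c - 1),
        C (Ideal.Quotient.mk I (∑ k, α (Sum.inr (a, k)) • e k)) * X ^ (a.1 + 1) := by
      simp only [hfdef, map_sum, Fintype.sum_sum_type, map_smul, map_add, Sum.elim_inl,
        Sum.elim_inr, map_mul, map_pow, splitVar_X_self,
        splitVar_killVar hg, Fintype.sum_prod_type]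
      congr 1
      · exact Finset.sum_congr rfl fun i _ => (hC _ _).symm
      · refine Finset.sum_congr rfl fun a _ => ?_
        rw [Finset.sum_mul]
        refine Finset.sum_congr rfl fun k _ => ?_
        rw [hC, smul_mul_assoc]
        exact congrArg _ (X_pow_mul (n := a.1 + 1))
    have hdeg : f.degree < c := by
      rw [hf]
      refine (degree_add_le _ _).trans_lt (max_lt ?_ ?_)
      · exact degree_C_le.trans_lt (by exact_mod_cast hc)
      · refine (degree_sum_le _ _).trans_lt ((Finset.sup_lt_iff ?_).2 fun a _ => ?_)
        · exact WithBot.bot_lt_coe _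
        · refine (degree_C_mul_X_pow_le _ _).trans_lt ?_
          have := a.2
          exact_mod_cast (by omega : a.1 + 1 < c)
    have hc0 : f.coeff 0 = Ideal.Quotient.mk I (∑ i, α (Sum.inl i) • b i) := by
      rw [hf]
      simp [coeff_X_pow]
    have hca : ∀ a : Fin (c - 1), f.coeff (a.1 + 1) =
        Ideal.Quotient.mk I (∑ k, α (Sum.inr (a, k)) • e k) := by
      intro a
      rw [hf, coeff_add, coeff_C_succ, zero_add, finsetSum_coeff]
      simp only [coeff_C_mul, coeff_X_pow, add_left_inj, Fin.val_inj, mul_ite, mul_one, mul_zero,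
        Finset.sum_ite_eq, Finset.mem_univ, if_true]
    have hJ : ∀ a ∈ I'.map (Ideal.Quotient.mk I), Ideal.Quotient.mk I s ^ c * a = 0 := by
      intro a ha
      obtain ⟨a, rfl⟩ := Ideal.Quotient.mk_surjective a
      rw [Ideal.mem_quotient_iff_mem hII'] at ha
      rw [← map_pow, ← map_mul, Ideal.Quotient.eq_zero_iff_mem]
      exact hs a ha
    obtain ⟨h0, h1⟩ := coeff_of_mem_blowupIdeal hJ hα' hdeg
    rintro (i | ⟨a, k⟩)
    · rw [hc0, Ideal.Quotient.eq_zero_iff_mem] at h0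
      exact hbl (fun i => α (Sum.inl i)) h0 i
    · have := h1 (a.1 + 1)
      rw [hca, Ideal.mem_quotient_iff_mem hII'] at this
      exact hel (fun k => α (Sum.inr (a, k))) this k
  · set v : ι ⊕ (Fin (c - 1) × κ) → MvPolynomial σ ℚ := Sum.elim (fun i => killVar g (b i))
      (fun x => MvPolynomial.X g ^ (x.1.1 + 1) * killVar g (e x.2)) with hv
    -- spanning: show that the span of the basis and the ideal together contain everything
    set W : Submodule ℚ (MvPolynomial σ ℚ) := Submodule.span ℚ (Set.range v) ⊔
      N.restrictScalars ℚ with hW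
    have hvW : ∀ i, v i ∈ W := fun i =>
      Submodule.mem_sup_left (Submodule.subset_span (Set.mem_range_self i))
    have hNW : ∀ a ∈ N, a ∈ W := fun a ha => Submodule.mem_sup_right ha
    have hkill : ∀ p, killVar g p ∈ W := by
      intro p
      obtain ⟨α, hα⟩ := hbs p
      have h1 := hNW _ (hI _ hα)
      rw [map_sub, map_sum] at h1
      refine (W.sub_mem_iff_left (W.sum_mem fun i _ => ?_)).1 h1
      rw [map_smul]
      exact W.smul_mem _ (hvW (Sum.inl i))
    have hmul : ∀ a p, a + 1 < c → MvPolynomial.X g ^ (a + 1) * killVar g p ∈ W := by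
      intro a p ha
      obtain ⟨α, hα⟩ := hes p
      have h1 := hNW _ (N.mul_mem_left (MvPolynomial.X g ^ a) (hI' _ hα))
      rw [← mul_assoc, ← pow_succ, map_sub, map_sum, mul_sub, Finset.mul_sum] at h1
      refine (W.sub_mem_iff_left (W.sum_mem fun i _ => ?_)).1 h1
      rw [map_smul, mul_smul_comm]
      exact W.smul_mem _ (hvW (Sum.inr (⟨a, by omega⟩, i)))
    have hpW : ∀ p, p ∈ W := by
      intro p
      -- `Ψ` evaluates a polynomial over the quotient by `I` at the variable `g`, modulo `N`
      set θ : MvPolynomial σ ℚ ⧸ I →ₐ[ℚ] MvPolynomial σ ℚ ⧸ N :=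
        Ideal.Quotient.liftₐ I ((Ideal.Quotient.mkₐ ℚ N).comp (killVar g)) (fun a ha =>
          Ideal.Quotient.eq_zero_iff_mem.2 (hI a ha)) with hθ
      have hθmk : ∀ q, θ (Ideal.Quotient.mk I q) = Ideal.Quotient.mk N (killVar g q) := by
        intro q; rfl
      set Ψ : (MvPolynomial σ ℚ ⧸ I)[X] →+* MvPolynomial σ ℚ ⧸ N :=
        eval₂RingHom (θ : MvPolynomial σ ℚ ⧸ I →+* MvPolynomial σ ℚ ⧸ N)
          (Ideal.Quotient.mk N (MvPolynomial.X g)) with hΨ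
      have hΨΦ : ∀ q, Ψ (splitVar g I q) = Ideal.Quotient.mk N q := by
        intro q
        have : Ψ.comp (splitVar g I : MvPolynomial σ ℚ →+* _) = Ideal.Quotient.mk N := by
          apply MvPolynomial.ringHom_ext
          · intro r
            have : MvPolynomial.C r = algebraMap ℚ (MvPolynomial σ ℚ) r := rfl
            rw [this, RingHom.comp_apply, RingHom.coe_coe, AlgHom.commutes]
            exact (RingHom.congr_fun (Subsingleton.elim (Ψ.comp (algebraMap ℚ _))
              ((Ideal.Quotient.mk N).comp (algebraMap ℚ _))) r)
          · intro k
            by_cases h : k = g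
            · subst h
              simp [splitVar_X_self, hΨ]
            · simp [splitVar_X_of_ne I h, hΨ, hθmk, killVar_X_of_ne h]
        exact RingHom.congr_fun this q
      have hmon : ((X + C (Ideal.Quotient.mk I s)) ^ c).Monic := (monic_X_add_C _).pow c
      have hdiv := modByMonic_add_div (splitVar g I p) ((X + C (Ideal.Quotient.mk I s)) ^ c)
      set f := splitVar g I p %ₘ (X + C (Ideal.Quotient.mk I s)) ^ c with hf
      have hfdeg : f.natDegree < c := by
        rcases subsingleton_or_nontrivial (MvPolynomial σ ℚ ⧸ I) with h | h
        · rw [Subsingleton.elim f 0, natDegree_zero]; omega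
        · have h1 := natDegree_modByMonic_lt (splitVar g I p) hmon (fun h1 => by
            have := congrArg natDegree h1
            rw [(monic_X_add_C _).natDegree_pow, natDegree_X_add_C, natDegree_one] at this
            omega)
          rwa [(monic_X_add_C _).natDegree_pow, natDegree_X_add_C, mul_one] at h1
      have hkp : Ψ f = Ideal.Quotient.mk N p := by
        rw [← hΨΦ, ← hdiv, map_add, map_mul, map_pow]
        have : Ψ (X + C (Ideal.Quotient.mk I s)) ^ c = 0 := by
          have h2 := Ideal.Quotient.eq_zero_iff_mem.2 hx
          rw [map_pow, map_add] at h2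
          simpa [hΨ, hθmk] using h2
        rw [this, zero_mul, add_zero]
      obtain ⟨u, hu⟩ := Ideal.Quotient.mk_surjective.comp_left (g := Ideal.Quotient.mk I) f.coeff
      have hsum : Ψ f = Ideal.Quotient.mk N
          (∑ a ∈ Finset.range c, MvPolynomial.X g ^ a * killVar g (u a)) := by
        rw [hΨ, coe_eval₂RingHom, eval₂_eq_sum_range' _ hfdeg, map_sum]
        refine Finset.sum_congr rfl fun a _ => ?_
        have hua : f.coeff a = Ideal.Quotient.mk I (u a) := (congrFun hu a).symm
        rw [hua, RingHom.coe_coe, hθmk, map_mul, map_pow, mul_comm]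
      rw [hkp, Ideal.Quotient.mk_eq_mk_iff_sub_mem] at hsum
      refine (W.sub_mem_iff_left (W.sum_mem fun a ha => ?_)).1 (hNW _ hsum)
      rw [Finset.mem_range] at ha
      rcases a with _ | a
      · simpa using hkill (u 0)
      · exact hmul a _ ha
    intro p
    obtain ⟨y, hy, z, hz, hyz⟩ := Submodule.mem_sup.1 (hpW p)
    obtain ⟨α, rfl⟩ := (Submodule.mem_span_range_iff_exists_fun ℚ).1 hy
    refine ⟨α, ?_⟩
    rw [← hyz, add_sub_cancel_left]
    exact hz
  · simp only [Fintype.sum_sum_type, Sum.elim_inl, Sum.elim_inr, Fintype.sum_prod_type, geomPoly,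
      Finset.sum_mul, pow_add _ _ (d' _), ← Finset.mul_sum, Finset.sum_range]

/-- A presentation may be changed along homogeneous maps that are mutually inverse modulo the
ideals. -/
theorem HasHilb.transfer {τ : Type*} {I : Ideal (MvPolynomial σ ℚ)} {I' : Ideal (MvPolynomial τ ℚ)}
    {H : ℤ[X]} (f : MvPolynomial τ ℚ →ₐ[ℚ] MvPolynomial σ ℚ)
    (g : MvPolynomial σ ℚ →ₐ[ℚ] MvPolynomial τ ℚ)
    (hghom : ∀ k, (g (MvPolynomial.X k)).IsHomogeneous 1)
    (hf : ∀ p ∈ I', f p ∈ I) (hg : ∀ p ∈ I, g p ∈ I')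
    (hfg : ∀ p, f (g p) - p ∈ I) (hgf : ∀ p, g (f p) - p ∈ I') (h : HasHilb I H) :
    HasHilb I' H := by
  obtain ⟨ι, _, b, d, hbd, hbl, hbs, rfl⟩ := h
  refine ⟨ι, inferInstance, fun i => g (b i), d, fun i => ?_, fun α hα => hbl α ?_,
    fun p => ?_, rfl⟩
  · have h1 := (hbd i).aeval (fun k => g (MvPolynomial.X k)) hghom
    rw [one_mul] at h1
    rwa [MvPolynomial.aeval_unique g]
  · have h1 := hf _ hα
    have h2 := hfg (∑ i, α i • b i)
    rw [map_sum] at h2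
    simp only [map_smul] at h2
    exact (I.sub_mem_iff_right h1).1 h2
  · obtain ⟨α, hα⟩ := hbs (f p)
    refine ⟨α, ?_⟩
    have h1 := hg _ hα
    have h2 := hgf p
    rw [map_sub, map_sum] at h1
    simp only [map_smul] at h1
    have := I'.sub_mem h1 h2
    convert this using 1
    ring

attribute [local instance] MvPolynomial.gradedAlgebra

/-- If `I` is homogeneous, the coefficients of `H` are the dimensions of the graded components of
the quotient by `I`. -/
theorem HasHilb.finrank_eq {I : Ideal (MvPolynomial σ ℚ)} {H : ℤ[X]} (h : HasHilb I H)
    (hI : I.IsHomogeneous (MvPolynomial.homogeneousSubmodule σ ℚ)) (j : ℕ) :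
    (Module.finrank ℚ ((MvPolynomial.homogeneousSubmodule σ ℚ j).map
      (Ideal.Quotient.mkₐ ℚ I).toLinearMap) : ℤ) = H.coeff j := by
  classical
  obtain ⟨ι, _, b, d, hbd, hbl, hbs, rfl⟩ := h
  set v : {i // d i = j} → MvPolynomial σ ℚ ⧸ I := fun i => Ideal.Quotient.mkₐ ℚ I (b i) with hv
  have hlin : LinearIndependent ℚ v := by
    rw [Fintype.linearIndependent_iff]
    intro α hα
    have h1 : ∑ i, (if h : d i = j then α ⟨i, h⟩ else 0) • b i ∈ I := by
      rw [← Ideal.Quotient.eq_zero_iff_mem, ← Ideal.Quotient.mkₐ_eq_mk ℚ, map_sum, ← hα]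
      simp only [hv, map_smul]
      rw [← Finset.sum_filter_add_sum_filter_not Finset.univ (fun i => d i = j),
        Finset.sum_eq_zero (s := Finset.univ.filter fun i => ¬ d i = j) (fun i hi => by
          simp [(Finset.mem_filter.1 hi).2]), add_zero,
        ← Finset.sum_subtype_eq_sum_filter]
      refine Finset.sum_congr (by ext; simp) fun i _ => ?_
      rw [dif_pos i.2]
    intro i
    have := hbl _ h1 i.1
    simpa [i.2] using this
  have hspan : Submodule.span ℚ (Set.range v) = (MvPolynomial.homogeneousSubmodule σ ℚ j).map
      (Ideal.Quotient.mkₐ ℚ I).toLinearMap := by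
    apply le_antisymm
    · rw [Submodule.span_le]
      rintro _ ⟨⟨i, rfl⟩, rfl⟩
      exact Submodule.mem_map_of_mem (hbd i)
    · rintro _ ⟨p, hp, rfl⟩
      obtain ⟨α, hα⟩ := hbs p
      have h1 := MvPolynomial.homogeneousComponent_mem_of_mem hI hα j
      rw [map_sub, MvPolynomial.homogeneousComponent_eq_self hp, map_sum,
        ← Ideal.Quotient.mk_eq_mk_iff_sub_mem] at h1
      change Ideal.Quotient.mk I p ∈ _
      rw [h1, ← Ideal.Quotient.mkₐ_eq_mk ℚ, map_sum]
      refine Submodule.sum_mem _ fun i _ => ?_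
      rw [map_smul, map_smul, MvPolynomial.homogeneousComponent_of_mem (hbd i)]
      split_ifs with hij
      · exact Submodule.smul_mem _ (α i)
          (Submodule.subset_span (Set.mem_range_self (f := v) ⟨i, hij.symm⟩))
      · simp
  rw [← hspan, finrank_span_eq_card hlin, finsetSum_coeff]
  simp [coeff_X_pow, Fintype.card_subtype, eq_comm]

end Step

/-! ### Chain ideals on a join-semilattice -/

section Tower

theorem mul_pow_congr {S : Type*} [CommMonoid S] {x a b : S} (h : x * a = x * b) (e : ℕ) :
    x * a ^ e = x * b ^ e := by
  induction e with
  | zero => simp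
  | succ e ih =>
    rw [pow_succ, pow_succ, ← mul_assoc, ih, mul_right_comm, h, mul_right_comm, mul_assoc]

variable {L : Type*} [SemilatticeSup L] [Fintype L]

open Classical in
/-- The sum of the variables `x_H` over all `H ≥ G`. -/
def upperSum (G : L) : MvPolynomial L ℚ := ∑ H with G ≤ H, MvPolynomial.X H

open Classical in
/-- The sum of the variables `x_H` over all `H > G`. -/
def strictUpperSum (G : L) : MvPolynomial L ℚ := ∑ H with G < H, MvPolynomial.X H

/-- An ideal of Feichtner--Yuzvinsky type: the variables outside `P` are killed, products of
incomparable variables vanish, and the sums `upperSum H` satisfy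
`x_K * upperSum H ^ (rk H - rk K) = 0` for `K < H`, and `upperSum H ^ (rk H - β) = 0` for `H ∈ P`.
The number `β` is the rank of a bottom element, which lies below `P` and has no variable. All
variables of `L` are kept, so that the rings for different `P` are quotients of one polynomial
ring. -/
def chainIdeal (rk : L → ℕ) (β : ℕ) (P : Set L) : Ideal (MvPolynomial L ℚ) :=
  Ideal.span {p | (∃ K, K ∉ P ∧ p = MvPolynomial.X K) ∨
    (∃ K H, ¬ K ≤ H ∧ ¬ H ≤ K ∧ p = MvPolynomial.X K * MvPolynomial.X H) ∨
    (∃ K H, K < H ∧ p = MvPolynomial.X K * upperSum H ^ (rk H - rk K)) ∨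
    ∃ H ∈ P, p = upperSum H ^ (rk H - β)}

variable {rk : L → ℕ} {β : ℕ} {P : Set L}

theorem chainIdeal_le {J : Ideal (MvPolynomial L ℚ)}
    (h1 : ∀ K, K ∉ P → MvPolynomial.X K ∈ J)
    (h2 : ∀ K H : L, ¬ K ≤ H → ¬ H ≤ K → MvPolynomial.X K * MvPolynomial.X H ∈ J)
    (h3 : ∀ K H : L, K < H → MvPolynomial.X K * upperSum H ^ (rk H - rk K) ∈ J)
    (h4 : ∀ H ∈ P, upperSum H ^ (rk H - β) ∈ J) : chainIdeal rk β P ≤ J := by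
  rw [chainIdeal, Ideal.span_le]
  rintro _ (⟨K, hK, rfl⟩ | ⟨K, H, hKH, hHK, rfl⟩ | ⟨K, H, hKH, rfl⟩ | ⟨H, hH, rfl⟩)
  exacts [h1 K hK, h2 K H hKH hHK, h3 K H hKH, h4 H hH]

theorem X_mem_chainIdeal {K : L} (hK : K ∉ P) : MvPolynomial.X K ∈ chainIdeal rk β P :=
  Ideal.subset_span (Or.inl ⟨K, hK, rfl⟩)

theorem X_mul_X_mem_chainIdeal {K H : L} (hKH : ¬ K ≤ H) (hHK : ¬ H ≤ K) :
    MvPolynomial.X K * MvPolynomial.X H ∈ chainIdeal rk β P :=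
  Ideal.subset_span (Or.inr (Or.inl ⟨K, H, hKH, hHK, rfl⟩))

theorem X_mul_pow_mem_chainIdeal {K H : L} (hKH : K < H) {e : ℕ} (he : rk H - rk K ≤ e) :
    MvPolynomial.X K * upperSum H ^ e ∈ chainIdeal rk β P := by
  obtain ⟨d, rfl⟩ := Nat.exists_eq_add_of_le he
  rw [pow_add, ← mul_assoc]
  exact Ideal.mul_mem_right _ _ (Ideal.subset_span (Or.inr (Or.inr (Or.inl ⟨K, H, hKH, rfl⟩))))

theorem pow_mem_chainIdeal {H : L} (hH : H ∈ P) {e : ℕ} (he : rk H - β ≤ e) :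
    upperSum H ^ e ∈ chainIdeal rk β P := by
  obtain ⟨d, rfl⟩ := Nat.exists_eq_add_of_le he
  rw [pow_add]
  exact Ideal.mul_mem_right _ _ (Ideal.subset_span (Or.inr (Or.inr (Or.inr ⟨H, hH, rfl⟩))))

theorem upperSum_eq_X_add (G : L) : upperSum G = MvPolynomial.X G + strictUpperSum G := by
  classical
  rw [upperSum, strictUpperSum, ← Finset.sum_insert (by simp)]
  refine Finset.sum_congr ?_ fun _ _ => rfl
  ext H
  simp [le_iff_eq_or_lt, eq_comm]

/-- Modulo the products of incomparable variables, multiplication by `x_K` does not distinguish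
the sum over `H ≥ G` from the sum over `H ≥ G ⊔ K`. -/
theorem X_mul_upperSum {J : Ideal (MvPolynomial L ℚ)}
    (hJ : ∀ K H : L, ¬ K ≤ H → ¬ H ≤ K → MvPolynomial.X K * MvPolynomial.X H ∈ J)
    {K G : L} (hGK : ¬ G ≤ K) :
    Ideal.Quotient.mk J (MvPolynomial.X K * upperSum G) =
      Ideal.Quotient.mk J (MvPolynomial.X K * upperSum (G ⊔ K)) := by
  classical
  have hsub : (Finset.univ.filter fun H : L => G ⊔ K ≤ H) ⊆ Finset.univ.filter fun H => G ≤ H := by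
    intro H
    simp only [Finset.mem_filter, Finset.mem_univ, true_and]
    exact le_sup_left.trans
  rw [Ideal.Quotient.mk_eq_mk_iff_sub_mem, ← mul_sub, upperSum, upperSum,
    ← Finset.sum_sdiff hsub, add_sub_cancel_right, Finset.mul_sum]
  refine J.sum_mem fun H hH => ?_
  simp only [Finset.mem_sdiff, Finset.mem_filter, Finset.mem_univ, true_and, sup_le_iff,
    not_and] at hH
  exact hJ K H (hH.2 hH.1) fun h => hGK (hH.1.trans h)

theorem killVar_upperSum {G H : L} (h : ¬ H ≤ G) : killVar G (upperSum H) = upperSum H := by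
  classical
  rw [upperSum, map_sum]
  refine Finset.sum_congr rfl fun K hK => killVar_X_of_ne ?_
  rintro rfl
  exact h (Finset.mem_filter.1 hK).2

theorem killVar_strictUpperSum (G : L) : killVar G (strictUpperSum G) = strictUpperSum G := by
  classical
  rw [strictUpperSum, map_sum]
  refine Finset.sum_congr rfl fun K hK => killVar_X_of_ne ?_
  rintro rfl
  exact lt_irrefl _ (Finset.mem_filter.1 hK).2

theorem splitVar_upperSum {G H : L} (h : ¬ H ≤ G) (I : Ideal (MvPolynomial L ℚ)) :
    splitVar G I (upperSum H) = C (Ideal.Quotient.mk I (upperSum H)) := by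
  classical
  rw [upperSum, map_sum, map_sum, map_sum]
  refine Finset.sum_congr rfl fun K hK => splitVar_X_of_ne I ?_
  rintro rfl
  exact h (Finset.mem_filter.1 hK).2

theorem splitVar_strictUpperSum (G : L) (I : Ideal (MvPolynomial L ℚ)) :
    splitVar G I (strictUpperSum G) = C (Ideal.Quotient.mk I (strictUpperSum G)) := by
  classical
  rw [strictUpperSum, map_sum, map_sum, map_sum]
  refine Finset.sum_congr rfl fun K hK => splitVar_X_of_ne I ?_
  rintro rfl
  exact lt_irrefl _ (Finset.mem_filter.1 hK).2

/-- A rank function on a join-semilattice: strictly monotone, and submodular above each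
element. -/
structure IsRankFunction (rk : L → ℕ) : Prop where
  strictMono : StrictMono rk
  sup_le : ∀ F G K : L, F ≤ G → F ≤ K → rk (G ⊔ K) + rk F ≤ rk G + rk K

/-- For `H > G`, the relation `upperSum H ^ (rk H - rk G) = 0` of the centre is annihilated by the
constant term of the relation that defines the new variable `x_G`. -/
theorem strictUpperSum_pow_mul_mem (hrk : IsRankFunction rk) {G H : L} (hGH : G < H) (hH : H ∈ P)
    (hβ : β ≤ rk G) :
    strictUpperSum G ^ (rk G - β) * upperSum H ^ (rk H - rk G) ∈ chainIdeal rk β P := by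
  classical
  have hGH' := hrk.strictMono hGH
  rw [← Ideal.Quotient.eq_zero_iff_mem, map_mul, map_pow, mul_comm]
  set m := Ideal.Quotient.mk (chainIdeal rk β P) with hm
  have key : m (upperSum H ^ (rk H - rk G)) * m (strictUpperSum G) =
      m (upperSum H ^ (rk H - rk G)) * m (upperSum H) := by
    have hsub : (Finset.univ.filter fun K : L => H ≤ K) ⊆ Finset.univ.filter fun K => G < K := by
      intro K
      simp only [Finset.mem_filter, Finset.mem_univ, true_and]
      exact hGH.trans_le
    rw [← map_mul, ← map_mul, hm, Ideal.Quotient.mk_eq_mk_iff_sub_mem, ← mul_sub, strictUpperSum]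
    nth_rw 2 [upperSum]
    rw [← Finset.sum_sdiff hsub, add_sub_cancel_right, Finset.mul_sum]
    refine Ideal.sum_mem _ fun K hK => ?_
    simp only [Finset.mem_sdiff, Finset.mem_filter, Finset.mem_univ, true_and] at hK
    have h1 := X_mul_upperSum (J := chainIdeal rk β P) (fun _ _ => X_mul_X_mem_chainIdeal) hK.2
    rw [map_mul, map_mul] at h1
    have h2 := mul_pow_congr h1 (rk H - rk G)
    rw [mul_comm, ← Ideal.Quotient.eq_zero_iff_mem, map_mul, map_pow, h2, ← map_pow, ← map_mul,
      Ideal.Quotient.eq_zero_iff_mem]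
    refine X_mul_pow_mem_chainIdeal (right_lt_sup.2 hK.2) ?_
    have := hrk.sup_le G H K hGH.le hK.1.le
    omega
  rw [mul_pow_congr key, ← map_pow, ← map_mul, ← pow_add, hm, Ideal.Quotient.eq_zero_iff_mem]
  exact pow_mem_chainIdeal hH (by omega)

/-- Adding a minimal element `G` to the upper set `P` is a blowup whose centre has the ring of the
interval above `G`. -/
theorem HasHilb.insert (hrk : IsRankFunction rk) {G : L} {H H' : ℤ[X]} (hGP : G ∉ P)
    (hP : IsUpperSet P) (hP' : ∀ K, G < K → K ∈ P) (hβ : β < rk G)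
    (hsup : ∀ K ∈ P, rk (G ⊔ K) + β ≤ rk G + rk K)
    (h : HasHilb (chainIdeal rk β P) H) (h' : HasHilb (chainIdeal rk (rk G) (Set.Ioi G)) H') :
    HasHilb (chainIdeal rk β (insert G P)) (H + geomPoly (rk G - β - 1) * H') := by
  have hnle : ∀ K ∈ P, ¬ K ≤ G := fun K hK h => hGP (hP h hK)
  refine HasHilb.adjoin (g := G) (I := chainIdeal rk β P) (I' := chainIdeal rk (rk G) (Set.Ioi G))
    (s := strictUpperSum G) (c := rk G - β) (by omega) ?_ (X_mem_chainIdeal hGP) ?_ ?_ ?_ ?_ ?_ h h'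
  -- the ring of the centre is a quotient: above `G`, `upperSum K` agrees with `upperSum (G ⊔ K)`
  · refine chainIdeal_le (fun K hK => X_mem_chainIdeal fun h => hK (hP' K h))
      (fun _ _ => X_mul_X_mem_chainIdeal) (fun _ _ h => X_mul_pow_mem_chainIdeal h le_rfl)
      (fun K hK => ?_)
    have h1 : Ideal.Quotient.mk (chainIdeal rk (rk G) (Set.Ioi G)) (upperSum K) =
        Ideal.Quotient.mk (chainIdeal rk (rk G) (Set.Ioi G)) (upperSum (G ⊔ K)) := by
      classical
      have hsub : (Finset.univ.filter fun H : L => G ⊔ K ≤ H) ⊆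
          Finset.univ.filter fun H => K ≤ H := by
        intro H
        simp only [Finset.mem_filter, Finset.mem_univ, true_and]
        exact le_sup_right.trans
      rw [Ideal.Quotient.mk_eq_mk_iff_sub_mem, upperSum, upperSum,
        ← Finset.sum_sdiff hsub, add_sub_cancel_right]
      refine Ideal.sum_mem _ fun H hH => X_mem_chainIdeal fun hGH => ?_
      simp only [Finset.mem_sdiff, Finset.mem_filter, Finset.mem_univ, true_and, sup_le_iff] at hH
      exact hH.2 ⟨le_of_lt hGH, hH.1⟩
    rw [← Ideal.Quotient.eq_zero_iff_mem, map_pow, h1, ← map_pow, Ideal.Quotient.eq_zero_iff_mem]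
    have := hsup K hK
    exact pow_mem_chainIdeal (left_lt_sup.2 (hnle K hK)) (by omega)
  -- `strictUpperSum G ^ (rk G - β)` kills the relations of the centre
  · intro a ha
    have : chainIdeal rk (rk G) (Set.Ioi G) ≤
        (chainIdeal rk β P).colon {strictUpperSum G ^ (rk G - β)} := by
      refine chainIdeal_le (fun K hK => ?_) (fun K H h1 h2 => ?_) (fun K H hKH => ?_)
        (fun H hH => ?_) <;> rw [Submodule.mem_colon_singleton, smul_eq_mul]
      · by_cases hKP : K ∈ P
        · have hGK : ¬ G ≤ K := fun h => hK (lt_of_le_of_ne h (by rintro rfl; exact hGP hKP))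
          have h1 := X_mul_upperSum (J := chainIdeal rk β P) (fun _ _ => X_mul_X_mem_chainIdeal) hGK
          have h2 : Ideal.Quotient.mk (chainIdeal rk β P)
              (MvPolynomial.X K * MvPolynomial.X G) = 0 :=
            Ideal.Quotient.eq_zero_iff_mem.2 (X_mul_X_mem_chainIdeal (hnle K hKP) hGK)
          rw [upperSum_eq_X_add G, mul_add, map_add, h2, zero_add, map_mul, map_mul] at h1
          have h3 := mul_pow_congr h1 (rk G - β)
          rw [← Ideal.Quotient.eq_zero_iff_mem, map_mul, map_pow, h3, ← map_pow, ← map_mul,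
            Ideal.Quotient.eq_zero_iff_mem]
          have := hsup K hKP
          exact X_mul_pow_mem_chainIdeal (right_lt_sup.2 hGK) (by omega)
        · exact Ideal.mul_mem_right _ _ (X_mem_chainIdeal hKP)
      · exact Ideal.mul_mem_right _ _ (X_mul_X_mem_chainIdeal h1 h2)
      · exact Ideal.mul_mem_right _ _ (X_mul_pow_mem_chainIdeal hKH le_rfl)
      · rw [mul_comm]
        exact strictUpperSum_pow_mul_mem hrk hH (hP' H hH) hβ.le
    have := Submodule.mem_colon_singleton.1 (this ha)
    rwa [smul_eq_mul, mul_comm] at this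
  -- the relations of the old ring, without the variable `x_G`, hold in the new one
  · intro a ha
    have : chainIdeal rk β P ≤ (chainIdeal rk β (Insert.insert G P)).comap (killVar G) := by
      refine chainIdeal_le (fun K hK => ?_) (fun K H h1 h2 => ?_) (fun K H hKH => ?_)
        (fun H hH => ?_) <;> rw [Ideal.mem_comap]
      · by_cases h : K = G
        · subst h; rw [killVar_X_self]; exact Ideal.zero_mem _
        · rw [killVar_X_of_ne h]; exact X_mem_chainIdeal (by simp [h, hK])
      · rw [map_mul]
        by_cases h : K = G
        · subst h; rw [killVar_X_self, zero_mul]; exact Ideal.zero_mem _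
        by_cases h' : H = G
        · subst h'; rw [killVar_X_self, mul_zero]; exact Ideal.zero_mem _
        rw [killVar_X_of_ne h, killVar_X_of_ne h']; exact X_mul_X_mem_chainIdeal h1 h2
      · rw [map_mul, map_pow]
        by_cases h : K = G
        · subst h; rw [killVar_X_self, zero_mul]; exact Ideal.zero_mem _
        rw [killVar_X_of_ne h]
        by_cases h' : H ≤ G
        · refine Ideal.mul_mem_right _ _ (X_mem_chainIdeal ?_)
          rintro (h1 | h1)
          exacts [h h1, hnle K h1 (hKH.le.trans h')]
        · rw [killVar_upperSum h']; exact X_mul_pow_mem_chainIdeal hKH le_rfl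
      · rw [map_pow, killVar_upperSum (hnle H hH)]
        exact pow_mem_chainIdeal (Set.mem_insert_of_mem _ hH) le_rfl
    exact this ha
  -- `x_G` times a relation of the centre is a relation of the new ring
  · intro a ha
    have : chainIdeal rk (rk G) (Set.Ioi G) ≤ ((chainIdeal rk β (Insert.insert G P)).colon
        {MvPolynomial.X G}).comap (killVar G) := by
      refine chainIdeal_le (fun K hK => ?_) (fun K H h1 h2 => ?_) (fun K H hKH => ?_)
        (fun H hH => ?_) <;> rw [Ideal.mem_comap, Submodule.mem_colon_singleton, smul_eq_mul]
      · by_cases h : K = G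
        · subst h; rw [killVar_X_self, zero_mul]; exact Ideal.zero_mem _
        · rw [killVar_X_of_ne h]
          by_cases h' : K ≤ G
          · refine Ideal.mul_mem_right _ _ (X_mem_chainIdeal ?_)
            rintro (h1 | h1)
            exacts [h h1, hnle K h1 h']
          · exact X_mul_X_mem_chainIdeal h' fun h1 => hK (lt_of_le_of_ne h1 (Ne.symm h))
      · refine Ideal.mul_mem_right _ _ ?_
        rw [map_mul]
        by_cases h : K = G
        · subst h; rw [killVar_X_self, zero_mul]; exact Ideal.zero_mem _
        by_cases h' : H = G
        · subst h'; rw [killVar_X_self, mul_zero]; exact Ideal.zero_mem _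
        rw [killVar_X_of_ne h, killVar_X_of_ne h']; exact X_mul_X_mem_chainIdeal h1 h2
      · refine Ideal.mul_mem_right _ _ ?_
        rw [map_mul, map_pow]
        by_cases h : K = G
        · subst h; rw [killVar_X_self, zero_mul]; exact Ideal.zero_mem _
        rw [killVar_X_of_ne h]
        by_cases h' : H ≤ G
        · refine Ideal.mul_mem_right _ _ (X_mem_chainIdeal ?_)
          rintro (h1 | h1)
          exacts [h h1, hnle K h1 (hKH.le.trans h')]
        · rw [killVar_upperSum h']; exact X_mul_pow_mem_chainIdeal hKH le_rfl
      · rw [map_pow, killVar_upperSum (not_le_of_gt hH), mul_comm]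
        exact X_mul_pow_mem_chainIdeal hH le_rfl
    have := Submodule.mem_colon_singleton.1 (Ideal.mem_comap.1 (this ha))
    rwa [smul_eq_mul, mul_comm] at this
  · rw [killVar_strictUpperSum, ← upperSum_eq_X_add]
    exact pow_mem_chainIdeal (Set.mem_insert _ _) le_rfl
  -- the new ring has no other relations
  · intro a ha
    set I := chainIdeal rk β P with hI
    have hIx : ∀ a ∈ chainIdeal rk (rk G) (Set.Ioi G), X * C (Ideal.Quotient.mk I a) ∈
        blowupIdeal ((chainIdeal rk (rk G) (Set.Ioi G)).map (Ideal.Quotient.mk I))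
          (Ideal.Quotient.mk I (strictUpperSum G)) (rk G - β) := fun a ha =>
      Ideal.mem_sup_left (Ideal.mul_mem_mul (Ideal.mem_span_singleton_self _)
        (Ideal.mem_map_of_mem _ (Ideal.mem_map_of_mem _ ha)))
    have hI0 : ∀ a ∈ I, C (Ideal.Quotient.mk I a) ∈
        blowupIdeal ((chainIdeal rk (rk G) (Set.Ioi G)).map (Ideal.Quotient.mk I))
          (Ideal.Quotient.mk I (strictUpperSum G)) (rk G - β) := fun a ha => by
      rw [Ideal.Quotient.eq_zero_iff_mem.2 ha, C_0]; exact Ideal.zero_mem _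
    have : chainIdeal rk β (Insert.insert G P) ≤ (blowupIdeal
        ((chainIdeal rk (rk G) (Set.Ioi G)).map (Ideal.Quotient.mk I))
          (Ideal.Quotient.mk I (strictUpperSum G)) (rk G - β)).comap (splitVar G I) := by
      refine chainIdeal_le (fun K hK => ?_) (fun K H h1 h2 => ?_) (fun K H hKH => ?_)
        (fun H hH => ?_) <;> rw [Ideal.mem_comap]
      · rw [Set.mem_insert_iff, not_or] at hK
        rw [splitVar_X_of_ne I hK.1]
        exact hI0 _ (X_mem_chainIdeal hK.2)
      · rw [map_mul]
        by_cases h : K = G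
        · subst h
          have h' : H ≠ K := by rintro rfl; exact h1 le_rfl
          rw [splitVar_X_self, splitVar_X_of_ne I h']
          exact hIx _ (X_mem_chainIdeal fun h3 => h1 (le_of_lt h3))
        by_cases h' : H = G
        · subst h'
          rw [splitVar_X_self, splitVar_X_of_ne I h, ← X_mul_C]
          exact hIx _ (X_mem_chainIdeal fun h3 => h2 (le_of_lt h3))
        rw [splitVar_X_of_ne I h, splitVar_X_of_ne I h', ← C_mul, ← map_mul]
        exact hI0 _ (X_mul_X_mem_chainIdeal h1 h2)
      · rw [map_mul, map_pow]
        by_cases h : K = G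
        · subst h
          rw [splitVar_X_self, splitVar_upperSum (not_le_of_gt hKH), ← C_pow, ← map_pow]
          exact hIx _ (pow_mem_chainIdeal hKH le_rfl)
        rw [splitVar_X_of_ne I h]
        by_cases h' : H ≤ G
        · exact Ideal.mul_mem_right _ _
            (hI0 _ (X_mem_chainIdeal fun h1 => hnle K h1 (hKH.le.trans h')))
        · rw [splitVar_upperSum h', ← C_pow, ← map_pow, ← C_mul, ← map_mul]
          exact hI0 _ (X_mul_pow_mem_chainIdeal hKH le_rfl)
      · rw [map_pow]
        rcases hH with rfl | hH
        · rw [upperSum_eq_X_add, map_add, splitVar_X_self, splitVar_strictUpperSum]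
          exact Ideal.mem_sup_right (Ideal.mem_span_singleton_self _)
        · rw [splitVar_upperSum (hnle H hH), ← C_pow, ← map_pow]
          exact hI0 _ (pow_mem_chainIdeal hH le_rfl)
    exact this ha

theorem hasHilb_chainIdeal_empty : HasHilb (chainIdeal rk β ∅) 1 := by
  have hI : chainIdeal rk β ∅ ≤ RingHom.ker (MvPolynomial.constantCoeff (R := ℚ) (σ := L)) :=
    chainIdeal_le (by simp [RingHom.mem_ker]) (by simp [RingHom.mem_ker])
      (by simp [RingHom.mem_ker]) (by simp)
  refine ⟨Unit, inferInstance, fun _ => 1, fun _ => 0, fun _ => MvPolynomial.isHomogeneous_one _ _,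
    fun α hα _ => ?_, fun p => ⟨fun _ => MvPolynomial.constantCoeff p, ?_⟩, by simp⟩
  · have := hI hα
    rw [RingHom.mem_ker] at this
    simpa using this
  · simp only [Finset.univ_unique, Finset.sum_singleton]
    rw [← Ideal.Quotient.eq_zero_iff_mem, map_sub, sub_eq_zero]
    have : (Ideal.Quotient.mkₐ ℚ (chainIdeal rk β ∅)) =
        (Ideal.Quotient.mkₐ ℚ (chainIdeal rk β ∅)).comp
          ((Algebra.ofId ℚ (MvPolynomial L ℚ)).comp (MvPolynomial.aeval fun _ => 0)) := by
      apply MvPolynomial.algHom_ext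
      intro k
      simpa using Ideal.Quotient.eq_zero_iff_mem.2 (X_mem_chainIdeal (Set.notMem_empty k))
    refine (DFunLike.congr_fun this p).trans ?_
    rw [AlgHom.comp_apply, AlgHom.comp_apply, Algebra.ofId_apply, MvPolynomial.aeval_zero',
      Algebra.algebraMap_eq_smul_one, Algebra.algebraMap_self_apply]
    rfl

/-- The elements of an upper set `P` are adjoined one by one, the minimal ones last. -/
theorem hasHilb_chainIdeal_finset (hrk : IsRankFunction rk) {H : L → ℤ[X]} (P : Finset L)
    (hP : IsUpperSet (P : Set L)) (hβ : ∀ G ∈ P, β < rk G)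
    (hsup : ∀ G ∈ P, ∀ K ∈ P, rk (G ⊔ K) + β ≤ rk G + rk K)
    (h : ∀ G ∈ P, HasHilb (chainIdeal rk (rk G) (Set.Ioi G)) (H G)) :
    HasHilb (chainIdeal rk β (P : Set L)) (1 + ∑ G ∈ P, geomPoly (rk G - β - 1) * H G) := by
  classical
  induction hn : P.card generalizing P with
  | zero =>
    rw [Finset.card_eq_zero.1 hn]
    simpa using hasHilb_chainIdeal_empty
  | succ m ih =>
    obtain ⟨G, hG, hmin⟩ := P.exists_minimal (Finset.card_pos.1 (by omega))
    have hQ : IsUpperSet ((P.erase G : Finset L) : Set L) := by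
      intro a b hab ha
      simp only [Finset.coe_erase, Set.mem_sdiff, Finset.mem_coe, Set.mem_singleton_iff] at ha ⊢
      refine ⟨hP hab ha.1, ?_⟩
      rintro rfl
      exact ha.2 (le_antisymm hab (hmin ha.1 hab))
    have h1 := ih (P.erase G) hQ (fun K hK => hβ K (Finset.mem_of_mem_erase hK))
      (fun K hK K' hK' => hsup K (Finset.mem_of_mem_erase hK) K' (Finset.mem_of_mem_erase hK'))
      (fun K hK => h K (Finset.mem_of_mem_erase hK)) (by rw [Finset.card_erase_of_mem hG, hn]; rfl)
    have h2 := HasHilb.insert hrk (by simp) hQ (fun K hK => by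
      simpa [hK.ne'] using hP hK.le hG) (hβ G hG)
      (fun K hK => hsup G hG K (Finset.mem_of_mem_erase hK)) h1 (h G hG)
    rw [← Finset.coe_insert, Finset.insert_erase hG] at h2
    rw [← Finset.add_sum_erase P _ hG]
    convert h2 using 1
    ring

open Classical in
/-- Polynomials that satisfy the Feichtner--Yuzvinsky recursion over the intervals above the
elements of `L` are the Hilbert polynomials of these intervals. -/
theorem hasHilb_chainIdeal_Ioi (hrk : IsRankFunction rk) {H : L → ℤ[X]}
    (hH : ∀ F, H F = 1 + ∑ G with F < G, geomPoly (rk G - rk F - 1) * H G) (F : L) :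
    HasHilb (chainIdeal rk (rk F) (Set.Ioi F)) (H F) := by
  induction F using WellFoundedGT.induction with
  | ind F ih =>
    have := hasHilb_chainIdeal_finset (β := rk F) (H := H) hrk (Finset.univ.filter fun G => F < G)
      (by intro a b hab ha; simp at ha ⊢; exact ha.trans_le hab)
      (by intro G hG; exact hrk.strictMono (Finset.mem_filter.1 hG).2)
      (fun G hG K hK => hrk.sup_le F G K (Finset.mem_filter.1 hG).2.le
        (Finset.mem_filter.1 hK).2.le)
      (fun G hG => ih G (Finset.mem_filter.1 hG).2)
    rw [← hH] at this
    convert this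
    ext; simp

open Classical in
/-- The Hilbert polynomial of the whole semilattice `L`, whose bottom element, of rank `0`, has been
removed. -/
theorem hasHilb_chainIdeal_univ (hrk : IsRankFunction rk) (hpos : ∀ F, 0 < rk F)
    (hsup : ∀ F G : L, rk (F ⊔ G) ≤ rk F + rk G) {H : L → ℤ[X]}
    (hH : ∀ F, H F = 1 + ∑ G with F < G, geomPoly (rk G - rk F - 1) * H G) :
    HasHilb (chainIdeal rk 0 Set.univ) (1 + ∑ G, geomPoly (rk G - 1) * H G) := by
  have := hasHilb_chainIdeal_finset (β := 0) (H := H) hrk Finset.univ (by simp [isUpperSet_univ])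
    (fun G _ => hpos G) (fun G _ K _ => hsup G K) (fun G _ => hasHilb_chainIdeal_Ioi hrk hH G)
  simpa using this

end Tower

/-! ### Presentations of Chow rings by flats -/

section Points

variable {L : Type*} [SemilatticeSup L] [Fintype L] {rk : L → ℕ}

/-- In a join-semilattice whose elements are separated by points `a i`, all relations of the chain
ideal follow from the products of incomparable variables, the products `x_F * upperSum (a i)` for
`a i` not below `F`, and the relations `upperSum H` for minimal elements `H`. The power relation of
`H` comes from that of an element `K` covered by `H`, as `upperSum H` and `upperSum K` have the same
product with `upperSum H`. -/
theorem chainIdeal_univ_le {ι : Type*} (hrk : IsRankFunction rk) (hpos : ∀ F, 0 < rk F)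
    {J : Ideal (MvPolynomial L ℚ)} (a : ι → L) (ha : ∀ K H : L, K < H → ∃ i, a i ≤ H ∧ ¬ a i ≤ K)
    (hJ : ∀ K H : L, ¬ K ≤ H → ¬ H ≤ K → MvPolynomial.X K * MvPolynomial.X H ∈ J)
    (hb : ∀ i F, ¬ a i ≤ F → MvPolynomial.X F * upperSum (a i) ∈ J)
    (hmin : ∀ H : L, (∀ K, ¬ K < H) → upperSum H ∈ J) : chainIdeal rk 0 Set.univ ≤ J := by
  classical
  have hcov : ∀ K H : L, K ⋖ H → ∀ F, K ≤ F → ¬ H ≤ F → MvPolynomial.X F * upperSum H ∈ J := by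
    intro K H hKH F hKF hHF
    obtain ⟨i, hiH, hiK⟩ := ha K H hKH.lt
    have hsup : a i ⊔ K = H := by
      refine (hKH.eq_or_eq le_sup_right (sup_le hiH hKH.le)).resolve_left fun h => hiK ?_
      exact h ▸ le_sup_left
    have hiF : ¬ a i ≤ F := fun h => hHF (hsup ▸ sup_le h hKF)
    have h1 := X_mul_upperSum hJ hiF
    have h2 := X_mul_upperSum hJ hHF
    rw [← hsup, sup_assoc, sup_eq_right.2 hKF, ← h1, hsup] at h2
    rw [← Ideal.Quotient.eq_zero_iff_mem, h2, Ideal.Quotient.eq_zero_iff_mem]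
    exact hb i F hiF
  have hsq : ∀ K H : L, K ⋖ H → ∀ e, Ideal.Quotient.mk J (upperSum H) ^ (e + 1) =
      Ideal.Quotient.mk J (upperSum H) * Ideal.Quotient.mk J (upperSum K) ^ e := by
    intro K H hKH e
    rw [pow_succ']
    refine mul_pow_congr ?_ e
    have hsub : (Finset.univ.filter fun F : L => H ≤ F) ⊆ Finset.univ.filter fun F => K ≤ F := by
      intro F
      simp only [Finset.mem_filter, Finset.mem_univ, true_and]
      exact hKH.le.trans
    rw [← map_mul, ← map_mul, eq_comm, Ideal.Quotient.mk_eq_mk_iff_sub_mem, ← mul_sub]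
    nth_rw 2 [upperSum]
    nth_rw 2 [upperSum]
    rw [← Finset.sum_sdiff hsub, add_sub_cancel_right, Finset.mul_sum]
    refine J.sum_mem fun F hF => ?_
    simp only [Finset.mem_sdiff, Finset.mem_filter, Finset.mem_univ, true_and] at hF
    rw [mul_comm]
    exact hcov K H hKH F hF.1 hF.2
  refine chainIdeal_le (by simp) hJ (fun K H => ?_) (fun H _ => ?_)
  · induction H using WellFoundedLT.induction with
    | ind H ih =>
      intro hKH
      obtain ⟨K', hK', hcK'⟩ := exists_le_covBy_of_lt hKH
      have h1 := hrk.strictMono hcK'.lt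
      have h2 := hrk.strictMono.monotone hK'
      obtain ⟨e, he⟩ : ∃ e, rk H - rk K = e + 1 := ⟨rk H - rk K - 1, by omega⟩
      rw [he]
      rcases hK'.eq_or_lt with rfl | hlt
      · rw [pow_succ', ← mul_assoc]
        exact J.mul_mem_right _ (hcov _ _ hcK' _ le_rfl (not_le_of_gt hcK'.lt))
      · rw [← Ideal.Quotient.eq_zero_iff_mem, map_mul, map_pow, hsq _ _ hcK', mul_left_comm,
          ← map_pow, ← map_mul, ← map_mul, Ideal.Quotient.eq_zero_iff_mem]
        refine J.mul_mem_left _ ?_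
        obtain ⟨d, rfl⟩ := Nat.exists_eq_add_of_le (show rk K' - rk K ≤ e by omega)
        rw [pow_add, ← mul_assoc]
        exact J.mul_mem_right _ (ih K' hcK'.lt hlt)
  · rw [Nat.sub_zero]
    induction H using WellFoundedLT.induction with
    | ind H ih =>
      by_cases hH : ∀ K, ¬ K < H
      · exact J.pow_mem_of_mem (hmin H hH) _ (hpos H)
      · push Not at hH
        obtain ⟨K, hKH⟩ := hH
        obtain ⟨K', hK', hcK'⟩ := exists_le_covBy_of_lt hKH
        have h1 := hrk.strictMono hcK'.lt
        obtain ⟨e, he⟩ : ∃ e, rk H = e + 1 := ⟨rk H - 1, by omega⟩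
        rw [he, ← Ideal.Quotient.eq_zero_iff_mem, map_pow, hsq _ _ hcK', ← map_pow,
          ← map_mul, Ideal.Quotient.eq_zero_iff_mem]
        refine J.mul_mem_left _ ?_
        obtain ⟨d, rfl⟩ := Nat.exists_eq_add_of_le (show rk K' ≤ e by omega)
        rw [pow_add]
        exact J.mul_mem_right _ (ih K' hcK'.lt trivial)

end Points

section Flats

variable {α : Type*} (M : Matroid α)

/-- The flats of a matroid. -/
abbrev Flat : Type _ := {F : Set α // M.IsFlat F}

/-- The rank of a set in a matroid, as a natural number. It is used for finite matroids only; an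
infinite rank would be read as `0`. -/
def setRank (F : Set α) : ℕ := (M.eRk F).toNat

variable {M}

theorem coe_setRank [Finite α] (F : Set α) : (setRank M F : ℕ∞) = M.eRk F := by
  refine ENat.natCast_toNat ?_
  rw [Matroid.eRk_ne_top_iff]
  exact M.isRkFinite_of_finite (Set.toFinite F)

theorem setRank_closure (F : Set α) : setRank M (M.closure F) = setRank M F := by
  rw [setRank, Matroid.eRk_closure_eq, setRank]

theorem setRank_mono [Finite α] {F G : Set α} (h : F ⊆ G) : setRank M F ≤ setRank M G := by
  have := M.eRk_mono h
  rw [← coe_setRank, ← coe_setRank] at this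
  exact_mod_cast this

theorem setRank_submod [Finite α] (F G : Set α) :
    setRank M (F ∩ G) + setRank M (F ∪ G) ≤ setRank M F + setRank M G := by
  have := M.eRk_inter_add_eRk_union_le F G
  simp only [← coe_setRank] at this
  exact_mod_cast this

theorem setRank_lt_of_ssubset [Finite α] {F G : Set α} (hF : M.IsFlat F) (hG : M.IsFlat G)
    (h : F ⊂ G) :
    setRank M F < setRank M G := by
  obtain ⟨e, heG, heF⟩ := Set.exists_of_ssubset h
  have h1 := M.eRk_insert_eq_add_one (X := F) (e := e) ⟨hG.subset_ground heG, by rwa [hF.closure]⟩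
  have h2 := M.eRk_mono (Set.insert_subset heG h.subset)
  rw [h1, ← coe_setRank, ← coe_setRank] at h2
  exact_mod_cast h2

theorem setRank_singleton [M.Loopless] {e : α} (he : e ∈ M.E) : setRank M {e} = 1 := by
  rw [setRank, Matroid.eRk_singleton_eq he]; rfl

theorem setRank_empty : setRank M ∅ = 0 := by simp [setRank]

theorem closure_subset_of_isFlat {F X : Set α} (hF : M.IsFlat F) (h : X ⊆ F) :
    M.closure X ⊆ F :=
  (M.closure_subset_closure h).trans hF.closure.subset

instance : SemilatticeSup (Flat M) :=
  { Subtype.partialOrder _ with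
    sup := fun F G => ⟨M.closure (F.1 ∪ G.1), M.isFlat_closure _⟩
    le_sup_left := fun F G => Set.subset_union_left.trans
      (M.subset_closure _ (Set.union_subset F.2.subset_ground G.2.subset_ground))
    le_sup_right := fun F G => Set.subset_union_right.trans
      (M.subset_closure _ (Set.union_subset F.2.subset_ground G.2.subset_ground))
    sup_le := fun _ _ H hF hG => closure_subset_of_isFlat H.2 (Set.union_subset hF hG) }

instance : SemilatticeSup (NonemptyFlat M) :=
  { Subtype.partialOrder _ with
    sup := fun F G => ⟨M.closure (F.1 ∪ G.1), M.isFlat_closure _,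
      (F.2.2.mono Set.subset_union_left).mono
      (M.subset_closure _ (Set.union_subset F.2.1.subset_ground G.2.1.subset_ground))⟩
    le_sup_left := fun F G => Set.subset_union_left.trans
      (M.subset_closure _ (Set.union_subset F.2.1.subset_ground G.2.1.subset_ground))
    le_sup_right := fun F G => Set.subset_union_right.trans
      (M.subset_closure _ (Set.union_subset F.2.1.subset_ground G.2.1.subset_ground))
    sup_le := fun _ _ H hF hG => closure_subset_of_isFlat H.2.1 (Set.union_subset hF hG) }

instance [Finite α] : Fintype (Flat M) := Fintype.ofFinite _

instance [Finite α] : Fintype (NonemptyFlat M) := Fintype.ofFinite _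

theorem setRank_sup_add_le [Finite α] {F G K : Set α} (hG : F ⊆ G) (hK : F ⊆ K) :
    setRank M (M.closure (G ∪ K)) + setRank M F ≤ setRank M G + setRank M K := by
  rw [setRank_closure]
  have h1 := setRank_submod (M := M) G K
  have h2 := setRank_mono (M := M) (Set.subset_inter hG hK)
  omega

theorem isRankFunction_nonemptyFlat [Finite α] :
    IsRankFunction fun F : NonemptyFlat M => setRank M F.1 where
  strictMono := fun F G h => setRank_lt_of_ssubset F.2.1 G.2.1 h
  sup_le _ _ _ hG hK := setRank_sup_add_le (M := M) hG hK

/-- On all flats, the rank is raised by one, as if a new bottom element were put below the empty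
flat. -/
theorem isRankFunction_flat [Finite α] : IsRankFunction fun F : Flat M => setRank M F.1 + 1 where
  strictMono := fun F G h => Nat.succ_lt_succ (setRank_lt_of_ssubset F.2 G.2 h)
  sup_le F G K hG hK := by
    have := setRank_sup_add_le (M := M) hG hK
    change setRank M (M.closure (G.1 ∪ K.1)) + 1 + _ ≤ _
    omega

theorem closure_singleton_subset_iff {F : Set α} (hF : M.IsFlat F) {i : α} (hi : i ∈ M.E) :
    M.closure {i} ⊆ F ↔ i ∈ F :=
  ⟨fun h => h (M.mem_closure_self i hi), fun h => closure_subset_of_isFlat hF (by simpa using h)⟩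

theorem isFlat_empty [M.Loopless] : M.IsFlat ∅ := by
  have := M.isFlat_closure ∅
  rwa [Matroid.closure_empty, Matroid.loops_eq_empty] at this

/-- The flats generated by single elements of the ground set. -/
def pointFlat (i : M.E) : Flat M := ⟨M.closure {i.1}, M.isFlat_closure _⟩

/-- The nonempty flats generated by single elements of the ground set. -/
def pointNonemptyFlat (i : M.E) : NonemptyFlat M :=
  ⟨M.closure {i.1}, M.isFlat_closure _, ⟨i.1, M.mem_closure_self i.1 i.2⟩⟩

theorem pointFlat_le_iff {i : M.E} {F : Flat M} : pointFlat i ≤ F ↔ i.1 ∈ F.1 :=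
  closure_singleton_subset_iff F.2 i.2

theorem pointNonemptyFlat_le_iff {i : M.E} {F : NonemptyFlat M} :
    pointNonemptyFlat i ≤ F ↔ i.1 ∈ F.1 :=
  closure_singleton_subset_iff F.2.1 i.2

variable [Fintype α]

open Classical in
theorem upperSum_pointFlat (i : M.E) :
    upperSum (pointFlat i) = ∑ F : Flat M with i.1 ∈ F.1, MvPolynomial.X F := by
  rw [upperSum]
  exact Finset.sum_congr (Finset.filter_congr fun F _ => pointFlat_le_iff) fun _ _ => rfl

open Classical in
theorem upperSum_pointNonemptyFlat (i : M.E) :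
    upperSum (pointNonemptyFlat i) = ∑ F : NonemptyFlat M with i.1 ∈ F.1, MvPolynomial.X F := by
  rw [upperSum]
  exact Finset.sum_congr (Finset.filter_congr fun F _ => pointNonemptyFlat_le_iff) fun _ _ => rfl

theorem setRank_pos_of_nonempty [M.Loopless] {F : Set α} (hF : M.IsFlat F) (hne : F.Nonempty) :
    0 < setRank M F := by
  obtain ⟨i, hi⟩ := hne
  have := setRank_mono (M := M) (Set.singleton_subset_iff.2 hi)
  rw [setRank_singleton (hF.subset_ground hi)] at this
  omega

/-- The Chow ring of a loopless matroid is presented by the chain ideal of its nonempty flats: the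
linear relation of an element `i` is that of the flat of rank one generated by `i`. -/
theorem chowIdeal_eq [M.Loopless] :
    chowIdeal M = chainIdeal (fun F : NonemptyFlat M => setRank M F.1) 0 Set.univ := by
  classical
  have hlin : ∀ i : M.E, upperSum (pointNonemptyFlat i) ∈ chowIdeal M := by
    intro i
    refine Ideal.mem_sup_right (Ideal.subset_span ⟨i.1, i.2, ?_⟩)
    rw [upperSum_pointNonemptyFlat]
    exact Finset.sum_congr (by ext; simp) fun _ _ => rfl
  apply le_antisymm
  · rw [chowIdeal, sup_le_iff, Ideal.span_le, Ideal.span_le]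
    constructor
    · rintro _ ⟨F, G, hFG, rfl⟩
      exact X_mul_X_mem_chainIdeal hFG.1 hFG.2
    · rintro _ ⟨i, hi, rfl⟩
      have h1 : upperSum (pointNonemptyFlat (M := M) ⟨i, hi⟩) ^ 1 ∈
          chainIdeal (fun F : NonemptyFlat M => setRank M F.1) 0 Set.univ := by
        refine pow_mem_chainIdeal (Set.mem_univ _) ?_
        change setRank M (M.closure {i}) - 0 ≤ 1
        rw [setRank_closure, setRank_singleton hi]
      rw [pow_one, upperSum_pointNonemptyFlat] at h1
      rw [SetLike.mem_coe]
      convert h1 using 1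
      exact Finset.sum_congr (by ext; simp) fun _ _ => rfl
  · refine chainIdeal_univ_le isRankFunction_nonemptyFlat
      (fun F => setRank_pos_of_nonempty F.2.1 F.2.2) pointNonemptyFlat (fun K H hKH => ?_)
      (fun K H h1 h2 => Ideal.mem_sup_left (Ideal.subset_span ⟨K, H, ⟨h1, h2⟩, rfl⟩))
      (fun i F _ => Ideal.mul_mem_left _ _ (hlin i)) (fun H hH => ?_)
    · obtain ⟨e, heH, heK⟩ := Set.exists_of_ssubset (show K.1 ⊂ H.1 from hKH)
      exact ⟨⟨e, H.2.1.subset_ground heH⟩, pointNonemptyFlat_le_iff.2 heH,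
        fun h => heK (pointNonemptyFlat_le_iff.1 h)⟩
    · obtain ⟨e, he⟩ := H.2.2
      have h1 : pointNonemptyFlat (M := M) ⟨e, H.2.1.subset_ground he⟩ ≤ H :=
        pointNonemptyFlat_le_iff.2 he
      rw [← h1.eq_or_lt.resolve_right (hH _)]
      exact hlin _

/-- The substitution that expresses the generators of the augmented Chow ring through one variable
for each flat: `y_i` goes to minus the sum of the `x_F` over the flats `F` containing `i`. The
variable of the ground set stands for minus the sum of all others, which is what the relation of the
empty flat says. -/
def augToFlat (M : Matroid α) : MvPolynomial (AugVar M) ℚ →ₐ[ℚ] MvPolynomial (Flat M) ℚ :=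
  MvPolynomial.aeval (Sum.elim (fun F => MvPolynomial.X ⟨F.1, F.2.1⟩)
    fun i => - upperSum (pointFlat i))

open Classical in
/-- A substitution that is inverse to `augToFlat` modulo the relations. -/
def flatToAug (M : Matroid α) : MvPolynomial (Flat M) ℚ →ₐ[ℚ] MvPolynomial (AugVar M) ℚ :=
  MvPolynomial.aeval fun F => if h : F.1 = M.E then
      - ∑ G : ProperFlat M, MvPolynomial.X (Sum.inl G)
    else MvPolynomial.X (Sum.inl ⟨F.1, F.2, h⟩)

theorem augToFlat_inl (F : ProperFlat M) :
    augToFlat M (MvPolynomial.X (Sum.inl F)) = MvPolynomial.X ⟨F.1, F.2.1⟩ := by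
  simp [augToFlat]

theorem augToFlat_inr (i : M.E) :
    augToFlat M (MvPolynomial.X (Sum.inr i)) = - upperSum (pointFlat i) := by
  simp [augToFlat]

theorem flatToAug_of_ne {F : Flat M} (h : F.1 ≠ M.E) :
    flatToAug M (MvPolynomial.X F) = MvPolynomial.X (Sum.inl ⟨F.1, F.2, h⟩) := by
  simp [flatToAug, h]

open Classical in
theorem flatToAug_ground :
    flatToAug M (MvPolynomial.X ⟨M.E, M.ground_isFlat⟩) =
      - ∑ G : ProperFlat M, MvPolynomial.X (Sum.inl G) := by
  simp [flatToAug]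

open Classical in
/-- A sum over flats is the term of the ground set plus the sum over the proper flats. -/
theorem sum_flat {A : Type*} [AddCommMonoid A] (f : Flat M → A) :
    ∑ F, f F = f ⟨M.E, M.ground_isFlat⟩ + ∑ F : ProperFlat M, f ⟨F.1, F.2.1⟩ := by
  rw [← Finset.add_sum_erase _ _ (Finset.mem_univ (⟨M.E, M.ground_isFlat⟩ : Flat M))]
  congr 1
  symm
  refine Finset.sum_bij (fun F _ => ⟨F.1, F.2.1⟩) ?_ ?_ ?_ ?_
  · intro F _
    simp only [Finset.mem_erase, Finset.mem_univ, and_true]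
    exact fun h => F.2.2 (congrArg Subtype.val h)
  · intro F _ G _ h
    exact Subtype.ext (congrArg (fun F : Flat M => F.1) h)
  · intro F hF
    refine ⟨⟨F.1, F.2, fun h => ?_⟩, Finset.mem_univ _, rfl⟩
    exact (Finset.mem_erase.1 hF).1 (Subtype.ext h)
  · intro _ _; rfl

open Classical in
theorem flatToAug_upperSum_pointFlat (i : M.E) : flatToAug M (upperSum (pointFlat i)) =
    - ∑ F : ProperFlat M with i.1 ∉ F.1, MvPolynomial.X (Sum.inl F) := by
  have h1 : ∑ F : ProperFlat M with i.1 ∈ F.1,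
      flatToAug M (MvPolynomial.X (⟨F.1, F.2.1⟩ : Flat M)) =
      ∑ F : ProperFlat M with i.1 ∈ F.1, MvPolynomial.X (Sum.inl F) :=
    Finset.sum_congr rfl fun F _ => flatToAug_of_ne F.2.2
  rw [upperSum_pointFlat, map_sum, Finset.sum_filter, sum_flat, if_pos i.2, flatToAug_ground,
    ← Finset.sum_filter, h1, ← Finset.sum_filter_add_sum_filter_not Finset.univ
      (fun F : ProperFlat M => i.1 ∈ F.1) (fun F => MvPolynomial.X (Sum.inl F))]
  ring

theorem flatToAug_isHomogeneous (F : Flat M) :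
    (flatToAug M (MvPolynomial.X F)).IsHomogeneous 1 := by
  classical
  by_cases h : F.1 = M.E
  · obtain ⟨F, hF⟩ := F
    subst h
    rw [flatToAug_ground]
    exact (MvPolynomial.IsHomogeneous.sum _ _ _ fun _ _ => MvPolynomial.isHomogeneous_X _ _).neg
  · rw [flatToAug_of_ne h]
    exact MvPolynomial.isHomogeneous_X _ _

theorem algHom_sub_mem {σ : Type*} {I : Ideal (MvPolynomial σ ℚ)}
    (f : MvPolynomial σ ℚ →ₐ[ℚ] MvPolynomial σ ℚ)
    (h : ∀ k, f (MvPolynomial.X k) - MvPolynomial.X k ∈ I) (p : MvPolynomial σ ℚ) :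
    f p - p ∈ I := by
  have : (Ideal.Quotient.mkₐ ℚ I).comp f = Ideal.Quotient.mkₐ ℚ I := by
    apply MvPolynomial.algHom_ext
    intro k
    exact (Ideal.Quotient.mk_eq_mk_iff_sub_mem _ _).2 (h k)
  exact (Ideal.Quotient.mk_eq_mk_iff_sub_mem _ _).1 (DFunLike.congr_fun this p)

theorem upperSum_empty [M.Loopless] : upperSum (⟨∅, isFlat_empty⟩ : Flat M) =
    ∑ F : Flat M, MvPolynomial.X F := by
  classical
  rw [upperSum, Finset.filter_true_of_mem]
  exact fun F _ => Set.empty_subset F.1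

theorem upperSum_empty_mem_chainIdeal [M.Loopless] : ∑ F : Flat M, MvPolynomial.X F ∈
    chainIdeal (fun F : Flat M => setRank M F.1 + 1) 0 Set.univ := by
  have h1 : upperSum (⟨∅, isFlat_empty⟩ : Flat M) ^ 1 ∈
      chainIdeal (fun F : Flat M => setRank M F.1 + 1) 0 Set.univ :=
    pow_mem_chainIdeal (Set.mem_univ _) (by rw [setRank_empty])
  rwa [pow_one, upperSum_empty] at h1

theorem augToFlat_mem [M.Loopless] {p : MvPolynomial (AugVar M) ℚ} (hp : p ∈ augChowIdeal M) :
    augToFlat M p ∈ chainIdeal (fun F : Flat M => setRank M F.1 + 1) 0 Set.univ := by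
  classical
  set I := chainIdeal (fun F : Flat M => setRank M F.1 + 1) 0 Set.univ with hI
  suffices h : augChowIdeal M ≤ I.comap (augToFlat M) from h hp
  rw [augChowIdeal, sup_le_iff, sup_le_iff, Ideal.span_le, Ideal.span_le, Ideal.span_le]
  refine ⟨⟨?_, ?_⟩, ?_⟩
  · rintro _ ⟨F, G, hFG, rfl⟩
    rw [SetLike.mem_coe, Ideal.mem_comap, map_mul, augToFlat_inl, augToFlat_inl]
    exact X_mul_X_mem_chainIdeal hFG.1 hFG.2
  · rintro _ ⟨i, F, hiF, rfl⟩
    rw [SetLike.mem_coe, Ideal.mem_comap, map_mul, augToFlat_inl, augToFlat_inr, neg_mul,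
      I.neg_mem_iff, mul_comm]
    have hle : ¬ pointFlat i ≤ (⟨F.1, F.2.1⟩ : Flat M) := fun h => hiF (pointFlat_le_iff.1 h)
    rw [← Ideal.Quotient.eq_zero_iff_mem,
      X_mul_upperSum (fun _ _ => X_mul_X_mem_chainIdeal) hle, Ideal.Quotient.eq_zero_iff_mem]
    have h1 := X_mul_pow_mem_chainIdeal (rk := fun F : Flat M => setRank M F.1 + 1) (β := 0)
      (P := Set.univ) (right_lt_sup.2 hle) (e := 1) (by
        have h1 := setRank_sup_add_le (M := M) (Set.empty_subset (M.closure {i.1}))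
          (Set.empty_subset F.1)
        rw [setRank_closure {i.1}, setRank_singleton i.2] at h1
        change setRank M (M.closure (M.closure {i.1} ∪ F.1)) + 1 - (setRank M F.1 + 1) ≤ 1
        omega)
    rwa [pow_one] at h1
  · rintro _ ⟨i, rfl⟩
    rw [SetLike.mem_coe, Ideal.mem_comap, map_sub, map_sum, augToFlat_inr]
    have h1 : - upperSum (pointFlat i) - ∑ F : ProperFlat M with i.1 ∉ F.1,
        augToFlat M (MvPolynomial.X (Sum.inl F)) = - ∑ F : Flat M, MvPolynomial.X F := by
      rw [upperSum_pointFlat, ← Finset.sum_filter_add_sum_filter_not Finset.univ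
        (fun F : Flat M => i.1 ∈ F.1) (fun F => MvPolynomial.X F), neg_add, sub_eq_add_neg]
      congr 2
      rw [Finset.sum_filter (fun F : Flat M => i.1 ∉ F.1), sum_flat, if_neg (by simp), zero_add,
        ← Finset.sum_filter]
      exact Finset.sum_congr rfl fun F _ => augToFlat_inl F
    convert I.neg_mem_iff.2 upperSum_empty_mem_chainIdeal using 1

theorem sub_mem_augChowIdeal (i : M.E) :
    MvPolynomial.X (Sum.inr i) + flatToAug M (upperSum (pointFlat i)) ∈ augChowIdeal M := by
  classical
  refine Ideal.mem_sup_right (Ideal.subset_span ⟨i, ?_⟩)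
  rw [flatToAug_upperSum_pointFlat, sub_eq_add_neg]

theorem flatToAug_mem [M.Loopless] {p : MvPolynomial (Flat M) ℚ}
    (hp : p ∈ chainIdeal (fun F : Flat M => setRank M F.1 + 1) 0 Set.univ) :
    flatToAug M p ∈ augChowIdeal M := by
  classical
  -- the empty flat is the only minimal one, and its relation is the definition of `x_E`
  refine chainIdeal_univ_le (J := (augChowIdeal M).comap (flatToAug M)) isRankFunction_flat
    (fun F => Nat.succ_pos _) pointFlat (fun K H hKH => ?_) (fun K H h1 h2 => ?_)
    (fun i F hiF => ?_) (fun H hH => ?_) hp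
  · obtain ⟨e, heH, heK⟩ := Set.exists_of_ssubset (show K.1 ⊂ H.1 from hKH)
    exact ⟨⟨e, H.2.subset_ground heH⟩, pointFlat_le_iff.2 heH,
      fun h => heK (pointFlat_le_iff.1 h)⟩
  · have hK : K.1 ≠ M.E := fun h => h2 (show H.1 ⊆ K.1 from h ▸ H.2.subset_ground)
    have hH : H.1 ≠ M.E := fun h => h1 (show K.1 ⊆ H.1 from h ▸ K.2.subset_ground)
    rw [Ideal.mem_comap, map_mul, flatToAug_of_ne hK, flatToAug_of_ne hH]
    exact Ideal.mem_sup_left (Ideal.mem_sup_left (Ideal.subset_span ⟨_, _, ⟨h1, h2⟩, rfl⟩))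
  · rw [pointFlat_le_iff] at hiF
    have hF : F.1 ≠ M.E := fun h => hiF (by rw [h]; exact i.2)
    rw [Ideal.mem_comap, map_mul, flatToAug_of_ne hF, mul_comm]
    have h1 := Ideal.mul_mem_right (MvPolynomial.X (Sum.inl ⟨F.1, F.2, hF⟩)) _
      (sub_mem_augChowIdeal i)
    rw [add_mul] at h1
    refine (Ideal.add_mem_iff_right _ ?_).1 h1
    exact Ideal.mem_sup_left (Ideal.mem_sup_right (Ideal.subset_span ⟨i, _, hiF, rfl⟩))
  · have h0 : H = ⟨∅, isFlat_empty⟩ := by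
      by_contra hne
      exact hH ⟨∅, isFlat_empty⟩ (lt_of_le_of_ne (Set.empty_subset H.1) (Ne.symm hne))
    subst h0
    rw [Ideal.mem_comap, upperSum_empty, map_sum, sum_flat, flatToAug_ground]
    have h1 : ∑ F : ProperFlat M, flatToAug M (MvPolynomial.X (⟨F.1, F.2.1⟩ : Flat M)) =
        ∑ F : ProperFlat M, MvPolynomial.X (Sum.inl F) :=
      Finset.sum_congr rfl fun F _ => flatToAug_of_ne F.2.2
    rw [h1, neg_add_cancel]
    exact Ideal.zero_mem _

/-- The augmented Chow ring is presented by the lattice of all flats, with ranks raised by one. -/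
theorem hasHilb_augChowIdeal [M.Loopless] {H : ℤ[X]}
    (h : HasHilb (chainIdeal (fun F : Flat M => setRank M F.1 + 1) 0 Set.univ) H) :
    HasHilb (augChowIdeal M) H := by
  classical
  refine h.transfer (augToFlat M) (flatToAug M) flatToAug_isHomogeneous
    (fun p hp => augToFlat_mem hp)
    (fun p hp => flatToAug_mem hp) (algHom_sub_mem ((augToFlat M).comp (flatToAug M)) ?_)
    (algHom_sub_mem ((flatToAug M).comp (augToFlat M)) ?_)
  · intro F
    rw [AlgHom.comp_apply]
    by_cases hF : F.1 = M.E
    · obtain ⟨F, hF'⟩ := F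
      subst hF
      rw [flatToAug_ground, map_neg, map_sum]
      have := neg_mem (upperSum_empty_mem_chainIdeal (M := M))
      rw [sum_flat, neg_add_rev, ← sub_eq_add_neg] at this
      have h1 : ∑ F : ProperFlat M, augToFlat M (MvPolynomial.X (Sum.inl F)) =
          ∑ F : ProperFlat M, MvPolynomial.X (⟨F.1, F.2.1⟩ : Flat M) :=
        Finset.sum_congr rfl fun F _ => augToFlat_inl F
      rwa [h1]
    · rw [flatToAug_of_ne hF, augToFlat_inl, sub_self]
      exact Ideal.zero_mem _
  · rintro (F | i)
    · rw [AlgHom.comp_apply, augToFlat_inl, flatToAug_of_ne F.2.2, sub_self]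
      exact Ideal.zero_mem _
    · rw [AlgHom.comp_apply, augToFlat_inr, map_neg, ← neg_add', Ideal.neg_mem_iff, add_comm]
      exact sub_mem_augChowIdeal i

attribute [local instance] MvPolynomial.gradedAlgebra

theorem chowIdeal_isHomogeneous :
    (chowIdeal M).IsHomogeneous (MvPolynomial.homogeneousSubmodule _ ℚ) := by
  refine Ideal.IsHomogeneous.sup (Ideal.homogeneous_span _ _ ?_) (Ideal.homogeneous_span _ _ ?_)
  · rintro _ ⟨F, G, -, rfl⟩
    exact ⟨2, (MvPolynomial.isHomogeneous_X _ _).mul (MvPolynomial.isHomogeneous_X _ _)⟩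
  · rintro _ ⟨i, -, rfl⟩
    exact ⟨1, MvPolynomial.IsHomogeneous.sum _ _ _ fun _ _ => MvPolynomial.isHomogeneous_X _ _⟩

theorem augChowIdeal_isHomogeneous :
    (augChowIdeal M).IsHomogeneous (MvPolynomial.homogeneousSubmodule _ ℚ) := by
  refine Ideal.IsHomogeneous.sup (Ideal.IsHomogeneous.sup (Ideal.homogeneous_span _ _ ?_)
    (Ideal.homogeneous_span _ _ ?_)) (Ideal.homogeneous_span _ _ ?_)
  · rintro _ ⟨F, G, -, rfl⟩
    exact ⟨2, (MvPolynomial.isHomogeneous_X _ _).mul (MvPolynomial.isHomogeneous_X _ _)⟩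
  · rintro _ ⟨i, F, -, rfl⟩
    exact ⟨2, (MvPolynomial.isHomogeneous_X _ _).mul (MvPolynomial.isHomogeneous_X _ _)⟩
  · rintro _ ⟨i, rfl⟩
    exact ⟨1, (MvPolynomial.isHomogeneous_X _ _).sub
      (MvPolynomial.IsHomogeneous.sum _ _ _ fun _ _ => MvPolynomial.isHomogeneous_X _ _)⟩

theorem hilbertSeries_chow_eq {H : ℤ[X]} (h : HasHilb (chowIdeal M) H) :
    (H : PowerSeries ℤ) = hilbertSeries (chowComponent M) := by
  ext j
  rw [Polynomial.coeff_coe, hilbertSeries, PowerSeries.coeff_mk,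
    ← h.finrank_eq chowIdeal_isHomogeneous]
  rfl

theorem hilbertSeries_augChow_eq {H : ℤ[X]} (h : HasHilb (augChowIdeal M) H) :
    (H : PowerSeries ℤ) = hilbertSeries (augChowComponent M) := by
  ext j
  rw [Polynomial.coeff_coe, hilbertSeries, PowerSeries.coeff_mk,
    ← h.finrank_eq augChowIdeal_isHomogeneous]
  rfl

end Flats

/-! ### Hilbert polynomials and their values at `-1` -/

section Recursion

/-- At `-1`, a rank jump of odd size `2 * m + 1` contributes nothing to the recursion. -/
theorem eval_geomPoly_two_mul (m : ℕ) : (geomPoly (2 * m)).eval (-1) = 0 := by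
  induction m with
  | zero => simp [geomPoly]
  | succ m ih =>
    have : geomPoly (2 * (m + 1)) = geomPoly (2 * m) + X ^ (2 * m + 1) + X ^ (2 * m + 1 + 1) := by
      rw [geomPoly, show 2 * (m + 1) = 2 * m + 1 + 1 by ring, Finset.sum_range_succ,
        Finset.sum_range_succ, geomPoly]
    rw [this, eval_add, eval_add, ih, eval_pow, eval_pow, eval_X, pow_succ (-1 : ℤ) (2 * m + 1)]
    ring

theorem eval_geomPoly_two_mul_add_one (m : ℕ) : (geomPoly (2 * m + 1)).eval (-1) = -1 := by
  have : geomPoly (2 * m + 1) = geomPoly (2 * m) + X ^ (2 * m + 1) := by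
    rw [geomPoly, Finset.sum_range_succ, geomPoly]
  rw [this, eval_add, eval_geomPoly_two_mul, eval_pow, eval_X, pow_succ, pow_mul]
  norm_num

theorem natDegree_geomPoly_le (m : ℕ) : (geomPoly m).natDegree ≤ m :=
  natDegree_sum_le_of_forall_le _ _ fun _ ha =>
    (natDegree_X_pow_le _).trans (Finset.mem_range.1 ha)

theorem coeff_geomPoly_self {m : ℕ} (hm : m ≠ 0) : (geomPoly m).coeff m = 1 := by
  obtain ⟨m, rfl⟩ := Nat.exists_eq_succ_of_ne_zero hm
  rw [geomPoly, finsetSum_coeff, Finset.sum_eq_single m]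
  · simp
  · intro b _ hb
    rw [coeff_X_pow, if_neg]
    omega
  · simp

/-- The Hilbert polynomial of the Chow ring of a matroid of rank `s`, obtained by truncation from a
lattice of rank `m` in which an interval of rank `m'` up to the top has `g m' j` elements of rank
`j`. The summand of index `j` belongs to the flats of rank `j + 1`, and the last one to the ground
set. -/
def chowPoly (g : ℕ → ℕ → ℕ) : ℕ → ℕ → ℤ[X]
  | 0, _ => 1
  | s + 1, m => 1 + ∑ j : Fin s,
      (g m (j + 1) : ℤ[X]) * geomPoly j * chowPoly g (s - j) (m - (j + 1)) + geomPoly s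
  termination_by s => s

theorem chowPoly_zero (g : ℕ → ℕ → ℕ) (m : ℕ) : chowPoly g 0 m = 1 := by rw [chowPoly]

theorem chowPoly_succ (g : ℕ → ℕ → ℕ) (s m : ℕ) : chowPoly g (s + 1) m =
    1 + ∑ j ∈ Finset.range s,
      (g m (j + 1) : ℤ[X]) * geomPoly j * chowPoly g (s - j) (m - (j + 1)) + geomPoly s := by
  rw [chowPoly, Finset.sum_range]

/-- The Hilbert polynomial of the augmented Chow ring, for the same data as `chowPoly`. -/
def augChowPoly (g : ℕ → ℕ → ℕ) (s m : ℕ) : ℤ[X] :=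
  1 + ∑ j ∈ Finset.range (s - 1),
    (g m (j + 1) : ℤ[X]) * geomPoly (j + 1) * chowPoly g (s - (j + 1)) (m - (j + 1)) + geomPoly s

theorem natDegree_chowPoly_le (g : ℕ → ℕ → ℕ) (s m : ℕ) :
    (chowPoly g (s + 1) m).natDegree ≤ s ∧ (chowPoly g (s + 1) m).coeff s = 1 := by
  induction s using Nat.strong_induction_on generalizing m with
  | _ s ih =>
    have hterm : ∀ j ∈ Finset.range s, ((g m (j + 1) : ℤ[X]) * geomPoly j *
        chowPoly g (s - j) (m - (j + 1))).natDegree ≤ s - 1 := by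
      intro j hj
      rw [Finset.mem_range] at hj
      have h1 := (ih (s - j - 1) (by omega) (m - (j + 1))).1
      rw [show s - j - 1 + 1 = s - j by omega] at h1
      have h2 := natDegree_geomPoly_le j
      refine natDegree_mul_le.trans ?_
      have h3 : ((g m (j + 1) : ℤ[X]) * geomPoly j).natDegree ≤ j :=
        natDegree_mul_le.trans (by rw [natDegree_natCast]; omega)
      omega
    have hsum := natDegree_sum_le_of_forall_le _ _ hterm
    rw [chowPoly_succ]
    refine ⟨natDegree_add_le_of_degree_le (natDegree_add_le_of_degree_le (by simp)
      (hsum.trans (Nat.sub_le _ _))) (natDegree_geomPoly_le s), ?_⟩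
    rcases Nat.eq_zero_or_pos s with rfl | hs
    · simp [geomPoly]
    · rw [coeff_add, coeff_add, coeff_geomPoly_self hs.ne', coeff_one, if_neg hs.ne',
        coeff_eq_zero_of_natDegree_lt (hsum.trans_lt (by omega))]
      ring

theorem natDegree_chowPoly (g : ℕ → ℕ → ℕ) (s m : ℕ) : (chowPoly g (s + 1) m).natDegree = s :=
  natDegree_eq_of_le_of_coeff_ne_zero (natDegree_chowPoly_le g s m).1
    (by rw [(natDegree_chowPoly_le g s m).2]; exact one_ne_zero)

theorem natDegree_augChowPoly (g : ℕ → ℕ → ℕ) (s m : ℕ) :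
    (augChowPoly g (s + 1) m).natDegree = s + 1 := by
  have hterm : ∀ j ∈ Finset.range s, ((g m (j + 1) : ℤ[X]) * geomPoly (j + 1) *
      chowPoly g (s + 1 - (j + 1)) (m - (j + 1))).natDegree ≤ s := by
    intro j hj
    rw [Finset.mem_range] at hj
    have h1 := (natDegree_chowPoly g (s - j - 1) (m - (j + 1)))
    rw [show s - j - 1 + 1 = s + 1 - (j + 1) by omega] at h1
    have h2 := natDegree_geomPoly_le (j + 1)
    refine natDegree_mul_le.trans ?_
    have h3 : ((g m (j + 1) : ℤ[X]) * geomPoly (j + 1)).natDegree ≤ j + 1 :=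
      natDegree_mul_le.trans (by rw [natDegree_natCast]; omega)
    omega
  have hsum := natDegree_sum_le_of_forall_le _ _ hterm
  refine natDegree_eq_of_le_of_coeff_ne_zero ?_ ?_
  · exact natDegree_add_le_of_degree_le (natDegree_add_le_of_degree_le (by simp)
      (hsum.trans (Nat.le_succ _))) (natDegree_geomPoly_le (s + 1))
  · rw [augChowPoly, coeff_add, coeff_add, coeff_geomPoly_self (Nat.succ_ne_zero s), coeff_one,
      if_neg (Nat.succ_ne_zero s), Nat.add_sub_cancel,
      coeff_eq_zero_of_natDegree_lt (hsum.trans_lt (by omega))]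
    simp

theorem sum_range_two_mul {A : Type*} [AddCommMonoid A] (f : ℕ → A) (u : ℕ) :
    ∑ j ∈ Finset.range (2 * u), f j =
      ∑ i ∈ Finset.range u, f (2 * i) + ∑ i ∈ Finset.range u, f (2 * i + 1) := by
  induction u with
  | zero => simp
  | succ u ih =>
    rw [show 2 * (u + 1) = 2 * u + 1 + 1 by ring, Finset.sum_range_succ, Finset.sum_range_succ, ih,
      Finset.sum_range_succ, Finset.sum_range_succ]
    abel

variable {g : ℕ → ℕ → ℕ} {A B : ℕ → ℕ → ℤ}

/-- The values at `-1` of the Hilbert polynomials of the Chow rings, from an alternating convolution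
identity that characterizes them. -/
theorem eval_chowPoly (hg : ∀ n, g n 0 = 1)
    (hA : ∀ u n, 2 * u < n → ∑ i ∈ Finset.range (u + 1),
      (g n (2 * i) : ℤ) * ((-1) ^ (u - i) * A (2 * (u - i)) (n - 2 * i)) = 1)
    (r n : ℕ) (hrn : r ≤ n) :
    (∀ u, r = 2 * u + 2 → (chowPoly g r n).eval (-1) = 0) ∧
    (∀ u, r = 2 * u + 1 → (chowPoly g r n).eval (-1) = (-1) ^ u * A (2 * u) n) := by
  induction r using Nat.strong_induction_on generalizing n with
  | _ r ih =>
    constructor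
    · rintro u rfl
      rw [chowPoly_succ, eval_add, eval_add, eval_one, eval_geomPoly_two_mul_add_one,
        eval_finsetSum, Finset.sum_eq_zero, add_zero, add_neg_cancel]
      intro j hj
      rw [Finset.mem_range] at hj
      rw [eval_mul, eval_mul]
      rcases Nat.even_or_odd' j with ⟨k, rfl | rfl⟩
      · rw [eval_geomPoly_two_mul]; ring
      · rw [(ih (2 * u + 1 - (2 * k + 1)) (by omega) (n - (2 * k + 1 + 1)) (by omega)).1 (u - k - 1)
          (by omega), mul_zero]
    · rintro u rfl
      rw [chowPoly_succ, eval_add, eval_add, eval_one, eval_geomPoly_two_mul, eval_finsetSum,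
        sum_range_two_mul, Finset.sum_eq_zero, zero_add, add_zero]
      · have h := hA u n (by omega)
        rw [Finset.sum_range_succ', hg] at h
        have h2 : ∑ i ∈ Finset.range u, eval (-1) ((g n (2 * i + 1 + 1) : ℤ[X]) *
            geomPoly (2 * i + 1) * chowPoly g (2 * u - (2 * i + 1)) (n - (2 * i + 1 + 1))) =
            - ∑ i ∈ Finset.range u, (g n (2 * (i + 1)) : ℤ) *
              ((-1) ^ (u - (i + 1)) * A (2 * (u - (i + 1))) (n - 2 * (i + 1))) := by
          rw [← Finset.sum_neg_distrib]
          refine Finset.sum_congr rfl fun i hi => ?_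
          rw [Finset.mem_range] at hi
          rw [eval_mul, eval_mul, eval_geomPoly_two_mul_add_one,
            (ih (2 * u - (2 * i + 1)) (by omega) (n - (2 * i + 1 + 1)) (by omega)).2 (u - (i + 1))
            (by omega), eval_natCast]
          ring_nf
        rw [h2]
        simp only [Nat.cast_one, one_mul, Nat.sub_zero, mul_zero] at h
        linear_combination -h
      · intro i _
        rw [eval_mul, eval_mul, eval_geomPoly_two_mul]; ring

/-- The values at `-1` of the Hilbert polynomials of the augmented Chow rings. -/
theorem eval_augChowPoly (hg : ∀ n, g n 0 = 1)
    (hA : ∀ u n, 2 * u < n → ∑ i ∈ Finset.range (u + 1),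
      (g n (2 * i) : ℤ) * ((-1) ^ (u - i) * A (2 * (u - i)) (n - 2 * i)) = 1)
    (hB : ∀ u n, 2 * u + 1 < n → ∑ i ∈ Finset.range (u + 1),
      (g n (2 * i + 1) : ℤ) * ((-1) ^ (u - i) * A (2 * (u - i)) (n - (2 * i + 1))) =
        1 + (-1) ^ u * B (2 * u + 1) n) (r n : ℕ) (hrn : r ≤ n) :
    (∀ u, r = 2 * u + 2 → (augChowPoly g r n).eval (-1) = (-1) ^ (u + 1) * B (2 * u + 1) n) ∧
    (∀ u, r = 2 * u + 1 → (augChowPoly g r n).eval (-1) = 0) := by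
  constructor
  · rintro u rfl
    set f : ℕ → ℤ := fun j => eval (-1) ((g n (j + 1) : ℤ[X]) * geomPoly (j + 1) *
      chowPoly g (2 * u + 2 - (j + 1)) (n - (j + 1))) with hf
    have hodd : ∑ i ∈ Finset.range u, f (2 * i + 1) = 0 := Finset.sum_eq_zero fun i _ => by
      simp only [hf]
      rw [eval_mul, eval_mul, show 2 * i + 1 + 1 = 2 * (i + 1) by ring, eval_geomPoly_two_mul]
      ring
    have heven : ∀ i ∈ Finset.range (u + 1), f (2 * i) =
        -((g n (2 * i + 1) : ℤ) * ((-1) ^ (u - i) * A (2 * (u - i)) (n - (2 * i + 1)))) := by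
      intro i hi
      rw [Finset.mem_range] at hi
      simp only [hf]
      rw [eval_mul, eval_mul, eval_geomPoly_two_mul_add_one, eval_natCast,
        (eval_chowPoly hg hA (2 * u + 2 - (2 * i + 1)) (n - (2 * i + 1)) (by omega)).2 (u - i)
        (by omega)]
      ring
    have h1 : eval (-1) (augChowPoly g (2 * u + 2) n) =
        1 + ∑ j ∈ Finset.range (2 * u + 1), f j := by
      rw [augChowPoly, eval_add, eval_add, eval_one, eval_finsetSum,
        show 2 * u + 2 - 1 = 2 * u + 1 by omega]
      nth_rw 2 [show 2 * u + 2 = 2 * (u + 1) by ring]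
      rw [eval_geomPoly_two_mul, add_zero]
    rw [h1, Finset.sum_range_succ, sum_range_two_mul, hodd, add_zero,
      ← Finset.sum_range_succ (fun i => f (2 * i)), Finset.sum_congr rfl heven,
      Finset.sum_neg_distrib, hB u n (by omega)]
    ring
  · rintro u rfl
    rw [augChowPoly, eval_add, eval_add, eval_one, eval_geomPoly_two_mul_add_one, eval_finsetSum,
      Finset.sum_eq_zero, add_zero, add_neg_cancel]
    intro j hj
    rw [Finset.mem_range] at hj
    rw [eval_mul, eval_mul]
    rcases Nat.even_or_odd' j with ⟨k, rfl | rfl⟩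
    · rw [(eval_chowPoly hg hA (2 * u + 1 - (2 * k + 1)) (n - (2 * k + 1)) (by omega)).1 (u - k - 1)
        (by omega), mul_zero]
    · rw [show 2 * k + 1 + 1 = 2 * (k + 1) by ring, eval_geomPoly_two_mul]; ring

end Recursion

/-! ### Descents and inversions of shuffles -/

section Permutations

theorem succ_mem_descentSet {n : ℕ} (σ : Equiv.Perm (Fin n)) (i : ℕ) :
    i + 1 ∈ descentSet σ ↔ ∃ h : i + 1 < n, σ ⟨i + 1, h⟩ < σ ⟨i, (Nat.lt_succ_self i).trans h⟩ := by
  simp only [descentSet, Finset.mem_image, Finset.mem_filter, Finset.mem_univ, true_and]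
  constructor
  · rintro ⟨⟨k, hk⟩, ⟨h, hlt⟩, hki⟩
    obtain rfl : k = i := by simpa using hki
    exact ⟨h, hlt⟩
  · rintro ⟨h, hlt⟩
    exact ⟨⟨i, _⟩, ⟨h, hlt⟩, rfl⟩

theorem zero_notMem_descentSet {n : ℕ} (σ : Equiv.Perm (Fin n)) : 0 ∉ descentSet σ := by
  simp [descentSet]

/-- The number of pairs consisting of an element of `A` and a smaller element of `C`. -/
def crossInv {n : ℕ} (A C : Finset (Fin n)) : ℕ := ∑ a ∈ A, ∑ c ∈ C, if c < a then 1 else 0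

/-- The Gaussian binomial coefficient, as the generating function of the `j`-element subsets `A` of
`Fin n` by the number of pairs `c < a` with `a ∈ A` and `c ∉ A`. -/
def gaussBinom (q n j : ℕ) : ℕ :=
  ∑ A ∈ Finset.powersetCard j (Finset.univ : Finset (Fin n)), q ^ crossInv A Aᶜ

theorem inversionNumber_eq_sum {n : ℕ} (σ : Equiv.Perm (Fin n)) :
    inversionNumber σ = ∑ x, ∑ y, if x < y ∧ σ y < σ x then 1 else 0 := by
  rw [inversionNumber, Finset.card_filter, ← Finset.univ_product_univ, Finset.sum_product]

variable {j l : ℕ}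

theorem card_compl_of_card {A : Finset (Fin (j + l))} (hA : A.card = j) : Aᶜ.card = l := by
  rw [Finset.card_compl, hA, Fintype.card_fin, Nat.add_sub_cancel_left]

/-- The permutation whose first `j` values are the elements of `A` in increasing order, and whose
other values are those of the complement of `A`, in the relative order of `τ`. -/
def shuffle (A : Finset (Fin (j + l))) (hA : A.card = j) (τ : Equiv.Perm (Fin l)) :
    Equiv.Perm (Fin (j + l)) :=
  finSumFinEquiv.symm.trans ((Equiv.sumCongr (Equiv.refl _) τ).trans
    (finSumEquivOfFinset hA (card_compl_of_card hA)))

variable {A : Finset (Fin (j + l))} (hA : A.card = j) (τ : Equiv.Perm (Fin l))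

theorem shuffle_castAdd (i : Fin j) : shuffle A hA τ (Fin.castAdd l i) = A.orderEmbOfFin hA i := by
  simp [shuffle]

theorem shuffle_natAdd (i : Fin l) : shuffle A hA τ (Fin.natAdd j i) =
    Aᶜ.orderEmbOfFin (card_compl_of_card hA) (τ i) := by
  simp [shuffle]

theorem sum_orderEmbOfFin {β : Type*} [AddCommMonoid β] {n k : ℕ} (B : Finset (Fin n))
    (hB : B.card = k) (f : Fin n → β) : ∑ i, f (B.orderEmbOfFin hB i) = ∑ b ∈ B, f b := by
  conv_rhs => rw [← Finset.map_orderEmbOfFin_univ B hB, Finset.sum_map]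
  rfl

theorem inversionNumber_shuffle :
    inversionNumber (shuffle A hA τ) = crossInv A Aᶜ + inversionNumber τ := by
  rw [inversionNumber_eq_sum, inversionNumber_eq_sum, Fin.sum_univ_add]
  simp only [Fin.sum_univ_add, shuffle_castAdd, shuffle_natAdd, OrderEmbedding.lt_iff_lt]
  have h1 : ∀ x y : Fin j, ¬ (Fin.castAdd l x < Fin.castAdd l y ∧ y < x) := by
    intro x y; simp only [Fin.lt_def, Fin.val_castAdd]; omega
  have h2 : ∀ (x : Fin j) (y : Fin l), Fin.castAdd l x < Fin.natAdd j y := by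
    intro x y; simp only [Fin.lt_def, Fin.val_castAdd, Fin.val_natAdd]; omega
  have h3 : ∀ (x : Fin l) (y : Fin j), ¬ Fin.natAdd j x < Fin.castAdd l y := by
    intro x y; simp only [Fin.lt_def, Fin.val_castAdd, Fin.val_natAdd]; omega
  have h4 : ∀ x y : Fin l, Fin.natAdd j x < Fin.natAdd j y ↔ x < y := by
    intro x y; simp only [Fin.lt_def, Fin.val_natAdd]; omega
  simp only [h1, h2, h3, h4, if_false, false_and, true_and, Finset.sum_const_zero, zero_add]
  congr 1
  rw [crossInv, ← sum_orderEmbOfFin A hA]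
  refine Finset.sum_congr rfl fun x _ => ?_
  rw [← sum_orderEmbOfFin Aᶜ (card_compl_of_card hA)]
  exact Equiv.sum_comp τ (fun y => if Aᶜ.orderEmbOfFin (card_compl_of_card hA) y <
    A.orderEmbOfFin hA x then 1 else 0)

theorem descentSet_shuffle_erase :
    (descentSet (shuffle A hA τ)).erase j = (descentSet τ).image (· + j) := by
  ext p
  simp only [Finset.mem_erase, Finset.mem_image]
  rcases p with _ | i
  · simp only [zero_notMem_descentSet, and_false, false_iff, not_exists, not_and]
    intro x hx h
    exact zero_notMem_descentSet τ (by rwa [show x = 0 by omega] at hx)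
  rw [succ_mem_descentSet]
  constructor
  · rintro ⟨hij, h, hlt⟩
    by_cases hi : i + 1 < j
    · exfalso
      have e1 : (⟨i + 1, h⟩ : Fin (j + l)) = Fin.castAdd l ⟨i + 1, hi⟩ := rfl
      have e2 : (⟨i, by omega⟩ : Fin (j + l)) = Fin.castAdd l ⟨i, by omega⟩ := rfl
      rw [e1, e2, shuffle_castAdd, shuffle_castAdd, OrderEmbedding.lt_iff_lt, Fin.lt_def] at hlt
      simp at hlt
    · obtain ⟨k, rfl⟩ := Nat.exists_eq_add_of_le (show j ≤ i by omega)
      refine ⟨k + 1, (succ_mem_descentSet _ _).2 ⟨by omega, ?_⟩, by omega⟩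
      have e1 : (⟨j + k + 1, h⟩ : Fin (j + l)) = Fin.natAdd j ⟨k + 1, by omega⟩ := rfl
      have e2 : (⟨j + k, by omega⟩ : Fin (j + l)) = Fin.natAdd j ⟨k, by omega⟩ := rfl
      rwa [e1, e2, shuffle_natAdd, shuffle_natAdd, OrderEmbedding.lt_iff_lt] at hlt
  · rintro ⟨x, hx, hxi⟩
    rcases x with _ | k
    · exact absurd hx (zero_notMem_descentSet τ)
    obtain rfl : i = j + k := by omega
    obtain ⟨h, hlt⟩ := (succ_mem_descentSet _ _).1 hx
    refine ⟨by omega, by omega, ?_⟩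
    have e1 : (⟨j + k + 1, by omega⟩ : Fin (j + l)) = Fin.natAdd j ⟨k + 1, by omega⟩ := rfl
    have e2 : (⟨j + k, by omega⟩ : Fin (j + l)) = Fin.natAdd j ⟨k, by omega⟩ := rfl
    rwa [e1, e2, shuffle_natAdd, shuffle_natAdd, OrderEmbedding.lt_iff_lt]

theorem image_shuffle_castAdd :
    (Finset.univ.image fun i : Fin j => shuffle A hA τ (Fin.castAdd l i)) = A := by
  simp only [shuffle_castAdd]
  ext a
  rw [← Finset.mem_coe, Finset.coe_image, Finset.coe_univ, Set.image_univ,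
    Finset.range_orderEmbOfFin, Finset.mem_coe]

theorem shuffle_injective {A' : Finset (Fin (j + l))} (hA' : A'.card = j) {τ' : Equiv.Perm (Fin l)}
    (h : shuffle A hA τ = shuffle A' hA' τ') : A = A' ∧ τ = τ' := by
  have hAA' : A = A' := by
    rw [← image_shuffle_castAdd hA τ, h, image_shuffle_castAdd]
  subst hAA'
  refine ⟨rfl, Equiv.ext fun i => ?_⟩
  have h1 := congrArg (fun σ => σ (Fin.natAdd j i)) h
  simpa [shuffle_natAdd] using h1

/-- A permutation without descents before position `j` is a shuffle. -/
theorem exists_shuffle_eq (σ : Equiv.Perm (Fin (j + l))) (hσ : ∀ i < j, i ∉ descentSet σ) :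
    ∃ (A : Finset (Fin (j + l))) (hA : A.card = j) (τ : Equiv.Perm (Fin l)),
      shuffle A hA τ = σ := by
  have hmono : StrictMono fun i : Fin j => σ (Fin.castAdd l i) := by
    rcases j with _ | j
    · exact fun i => i.elim0
    rw [Fin.strictMono_iff_lt_succ]
    intro i
    have h1 := hσ (i + 1) (by omega)
    rw [succ_mem_descentSet] at h1
    push Not at h1
    refine lt_of_le_of_ne (h1 (by omega)) fun h => ?_
    have := congrArg Fin.val (σ.injective h)
    simp at this
  set A : Finset (Fin (j + l)) := Finset.univ.image fun i : Fin j => σ (Fin.castAdd l i) with hAdef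
  have hA : A.card = j := by
    rw [hAdef, Finset.card_image_of_injective _ hmono.injective, Finset.card_univ, Fintype.card_fin]
  have hcast : ∀ i, A.orderEmbOfFin hA i = σ (Fin.castAdd l i) := by
    intro i
    exact (congrFun (Finset.orderEmbOfFin_unique hA
      (fun i => Finset.mem_image_of_mem _ (Finset.mem_univ i)) hmono) i).symm
  have hmem : ∀ i : Fin l, σ (Fin.natAdd j i) ∈ Aᶜ := by
    intro i
    simp only [hAdef, Finset.mem_compl, Finset.mem_image, Finset.mem_univ, true_and, not_exists]
    intro k hk
    have := congrArg Fin.val (σ.injective hk)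
    simp at this
    omega
  set t : Fin l → Fin l := fun i =>
    (Aᶜ.orderIsoOfFin (card_compl_of_card hA)).symm ⟨σ (Fin.natAdd j i), hmem i⟩ with ht
  have htinj : Function.Injective t := by
    intro x y hxy
    have h1 := congrArg Subtype.val ((OrderIso.injective _) hxy)
    have h2 := σ.injective h1
    simpa using h2
  refine ⟨A, hA, Equiv.ofBijective t (Finite.injective_iff_bijective.1 htinj),
    Equiv.ext fun x => ?_⟩
  refine Fin.addCases (fun i => ?_) (fun i => ?_) x
  · rw [shuffle_castAdd, hcast]
  · rw [shuffle_natAdd, Equiv.ofBijective_apply, ← Finset.coe_orderIsoOfFin_apply, ht]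
    simp

/-- The generating function by inversions of the permutations with descent set `S`. -/
def descentGF (q n : ℕ) (S : Finset ℕ) : ℤ :=
  ∑ σ : Equiv.Perm (Fin n) with descentSet σ = S, (q : ℤ) ^ inversionNumber σ

/-- Prescribing the relative order of the last `l` values by a descent set, and leaving free whether
there is a descent at `j`, multiplies the generating function by a Gaussian binomial coefficient. -/
theorem gaussBinom_mul_descentGF (q j l : ℕ) (S : Finset ℕ) :
    (gaussBinom q (j + l) j : ℤ) * descentGF q l S =
      ∑ σ : Equiv.Perm (Fin (j + l)) with (descentSet σ).erase j = S.image (· + j),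
        (q : ℤ) ^ inversionNumber σ := by
  rw [gaussBinom, descentGF, Nat.cast_sum, Finset.sum_mul_sum, ← Finset.sum_product']
  refine Finset.sum_bij (fun p hp => shuffle p.1
    (Finset.mem_powersetCard.1 (Finset.mem_product.1 hp).1).2 p.2) ?_ ?_ ?_ ?_
  · rintro ⟨A, τ⟩ hp
    simp only [Finset.mem_product, Finset.mem_filter, Finset.mem_univ, true_and] at hp ⊢
    rw [descentSet_shuffle_erase, hp.2]
  · rintro ⟨A, τ⟩ hp ⟨A', τ'⟩ hp' h
    obtain ⟨h1, h2⟩ := shuffle_injective _ _ _ h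
    exact Prod.ext h1 h2
  · intro σ hσ
    simp only [Finset.mem_filter, Finset.mem_univ, true_and] at hσ
    obtain ⟨A, hA, τ, rfl⟩ := exists_shuffle_eq σ (fun i hi hmem => by
      have h1 : i ∈ S.image (· + j) := hσ ▸ Finset.mem_erase.2 ⟨hi.ne, hmem⟩
      obtain ⟨x, -, hx⟩ := Finset.mem_image.1 h1
      omega)
    refine ⟨(A, τ), ?_, rfl⟩
    rw [descentSet_shuffle_erase] at hσ
    simp only [Finset.mem_product, Finset.mem_powersetCard, Finset.subset_univ, true_and, hA,
      Finset.mem_filter, Finset.mem_univ]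
    exact Finset.image_injective (add_left_injective j) hσ
  · rintro ⟨A, τ⟩ hp
    rw [inversionNumber_shuffle, pow_add]
    push_cast
    rfl

end Permutations

/-! ### Alternating descent sets -/

section Alternating

/-- The set of integers in `[t, m]` with the parity of `m`. -/
def alternatingSet (t m : ℕ) : Finset ℕ := (Finset.Icc t m).filter fun x => Even (x + m)

theorem mem_alternatingSet {t m x : ℕ} :
    x ∈ alternatingSet t m ↔ t ≤ x ∧ x ≤ m ∧ Even (x + m) := by
  simp [alternatingSet, and_assoc]

theorem evenSet_two_mul (u : ℕ) : evenSet (2 * u) = alternatingSet 2 (2 * u) := by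
  ext x
  simp only [evenSet, mem_alternatingSet, Finset.mem_filter, Finset.mem_Icc, Nat.even_iff]
  omega

theorem oddSet_two_mul_add_one (u : ℕ) : oddSet (2 * u + 1) = alternatingSet 1 (2 * u + 1) := by
  ext x
  simp only [oddSet, mem_alternatingSet, Finset.mem_filter, Finset.mem_Icc, Nat.even_iff,
    Nat.odd_iff]
  omega

theorem descentGF_empty (q n : ℕ) : descentGF q n ∅ = 1 := by
  have h : (Finset.univ.filter fun σ : Equiv.Perm (Fin n) => descentSet σ = ∅) = {1} := by
    ext σ
    simp only [Finset.mem_filter, Finset.mem_univ, true_and, Finset.mem_singleton]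
    rcases n with _ | n
    · exact ⟨fun _ => Subsingleton.elim _ _, fun _ => by simp [descentSet]⟩
    constructor
    · intro h
      have hmono : StrictMono σ := by
        rw [Fin.strictMono_iff_lt_succ]
        intro i
        have h1 : i.1 + 1 ∉ descentSet σ := h ▸ Finset.notMem_empty _
        rw [succ_mem_descentSet] at h1
        push Not at h1
        refine lt_of_le_of_ne (h1 (by omega)) fun h => ?_
        have := congrArg Fin.val (σ.injective h)
        simp at this
      ext x
      exact congrArg Fin.val (congrFun ((hmono.range_inj (g := id) strictMono_id).1
        (by simp [σ.surjective.range_eq])) x)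
    · rintro rfl
      rw [Finset.eq_empty_iff_forall_notMem]
      rintro (_ | i)
      · exact zero_notMem_descentSet _
      · rw [succ_mem_descentSet]
        rintro ⟨h, hlt⟩
        simp [Fin.lt_def] at hlt
  rw [descentGF, h, Finset.sum_singleton, inversionNumber, Finset.card_eq_zero.2, pow_zero]
  rw [Finset.filter_eq_empty_iff]
  rintro ⟨x, y⟩ - ⟨h1, h2⟩
  exact lt_asymm h1 h2

/-- Splitting by whether there is a descent at `j` gives two consecutive terms, whose alternating
sum over `j` telescopes. -/
theorem gaussBinom_mul_descentGF_evenSet (q : ℕ) {n m j : ℕ} (hjm : j ≤ m) (hmn : m < n)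
    (hpar : Even (j + m)) : (gaussBinom q n j : ℤ) * descentGF q (n - j) (evenSet (m - j)) =
      descentGF q n (alternatingSet j m) + descentGF q n (alternatingSet (j + 2) m) := by
  obtain ⟨l, rfl⟩ := Nat.exists_eq_add_of_le (show j ≤ n by omega)
  rw [Nat.even_iff] at hpar
  have hT : (evenSet (m - j)).image (· + j) = alternatingSet (j + 2) m := by
    ext x
    simp only [evenSet, mem_alternatingSet, Finset.mem_filter, Finset.mem_Icc, Finset.mem_image,
      Nat.even_iff]
    constructor
    · rintro ⟨y, hy, rfl⟩; omega
    · intro hx; exact ⟨x - j, by omega, by omega⟩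
  have hins : alternatingSet j m = insert j (alternatingSet (j + 2) m) := by
    ext x
    simp only [mem_alternatingSet, Finset.mem_insert, Nat.even_iff]
    omega
  have hnot : j ∉ alternatingSet (j + 2) m := by simp [mem_alternatingSet]
  rw [Nat.add_sub_cancel_left, gaussBinom_mul_descentGF, hT, descentGF, descentGF,
    ← Finset.sum_union]
  · refine Finset.sum_congr ?_ fun _ _ => rfl
    ext σ
    simp only [Finset.mem_filter, Finset.mem_univ, true_and, Finset.mem_union, hins]
    constructor
    · intro h
      by_cases hmem : j ∈ descentSet σ
      · exact Or.inl (by rw [← h, Finset.insert_erase hmem])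
      · exact Or.inr (by rw [← h, Finset.erase_eq_of_notMem hmem])
    · rintro (h | h)
      · rw [h, Finset.erase_insert hnot]
      · rw [h, Finset.erase_eq_of_notMem hnot]
  · rw [Finset.disjoint_left]
    intro σ h1 h2
    simp only [Finset.mem_filter, Finset.mem_univ, true_and] at h1 h2
    rw [h2, hins] at h1
    exact hnot (h1 ▸ Finset.mem_insert_self _ _)

theorem sum_alternating_telescope (b : ℕ → ℤ) (u : ℕ) :
    ∑ i ∈ Finset.range (u + 1), (-1) ^ (u - i) * (b i + b (i + 1)) =
      b (u + 1) + (-1) ^ u * b 0 := by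
  induction u with
  | zero => simp; ring
  | succ u ih =>
    rw [Finset.sum_range_succ]
    have : ∑ i ∈ Finset.range (u + 1), (-1 : ℤ) ^ (u + 1 - i) * (b i + b (i + 1)) =
        - ∑ i ∈ Finset.range (u + 1), (-1) ^ (u - i) * (b i + b (i + 1)) := by
      rw [← Finset.sum_neg_distrib]
      refine Finset.sum_congr rfl fun i hi => ?_
      rw [Nat.succ_sub (Nat.lt_succ_iff.1 (Finset.mem_range.1 hi)), pow_succ]
      ring
    rw [this, ih, Nat.sub_self]
    ring

theorem gaussBinom_zero_right (q n : ℕ) : gaussBinom q n 0 = 1 := by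
  simp [gaussBinom, crossInv]

theorem alternatingSet_eq_empty {t m : ℕ} (h : m < t) : alternatingSet t m = ∅ := by
  ext x
  simp only [mem_alternatingSet, Finset.notMem_empty, iff_false]
  omega

/-- The convolution identity that determines the generating functions of the descent sets
`{2, 4, …, 2 u}`. -/
theorem sum_gaussBinom_evenSet (q : ℕ) {u n : ℕ} (hn : 2 * u < n) :
    ∑ i ∈ Finset.range (u + 1), (gaussBinom q n (2 * i) : ℤ) *
      ((-1) ^ (u - i) * descentGF q (n - 2 * i) (evenSet (2 * (u - i)))) = 1 := by
  -- there is no descent at `0`, so the term `i = 0` contributes to only one of the two summands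
  set b : ℕ → ℤ := fun i => if i = 0 then 0 else descentGF q n (alternatingSet (2 * i) (2 * u))
    with hb
  have h : ∀ i ∈ Finset.range (u + 1), (gaussBinom q n (2 * i) : ℤ) *
      ((-1) ^ (u - i) * descentGF q (n - 2 * i) (evenSet (2 * (u - i)))) =
      (-1) ^ (u - i) * (b i + b (i + 1)) := by
    intro i hi
    rw [Finset.mem_range] at hi
    rcases i with _ | i
    · simp [hb, gaussBinom_zero_right, evenSet_two_mul]
    · have := gaussBinom_mul_descentGF_evenSet q (n := n) (m := 2 * u) (j := 2 * (i + 1))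
        (by omega) hn (by simp [Nat.even_add])
      rw [show 2 * u - 2 * (i + 1) = 2 * (u - (i + 1)) by omega] at this
      rw [mul_left_comm, this]
      simp [hb, mul_add]
  rw [Finset.sum_congr rfl h, sum_alternating_telescope]
  simp [hb, alternatingSet_eq_empty, descentGF_empty]

/-- The same convolution with odd shifts gives the generating function of the descent set
`{1, 3, …, 2 u + 1}`. -/
theorem sum_gaussBinom_oddSet (q : ℕ) {u n : ℕ} (hn : 2 * u + 1 < n) :
    ∑ i ∈ Finset.range (u + 1), (gaussBinom q n (2 * i + 1) : ℤ) *
      ((-1) ^ (u - i) * descentGF q (n - (2 * i + 1)) (evenSet (2 * (u - i)))) =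
      1 + (-1) ^ u * descentGF q n (oddSet (2 * u + 1)) := by
  have h : ∀ i ∈ Finset.range (u + 1), (gaussBinom q n (2 * i + 1) : ℤ) *
      ((-1) ^ (u - i) * descentGF q (n - (2 * i + 1)) (evenSet (2 * (u - i)))) =
      (-1) ^ (u - i) * (descentGF q n (alternatingSet (2 * i + 1) (2 * u + 1)) +
        descentGF q n (alternatingSet (2 * (i + 1) + 1) (2 * u + 1))) := by
    intro i hi
    rw [Finset.mem_range] at hi
    have := gaussBinom_mul_descentGF_evenSet q (n := n) (m := 2 * u + 1) (j := 2 * i + 1)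
      (by omega) hn (by rw [Nat.even_iff]; omega)
    rw [show 2 * u + 1 - (2 * i + 1) = 2 * (u - i) by omega] at this
    rw [mul_left_comm, this, show 2 * (i + 1) + 1 = 2 * i + 1 + 2 by ring]
  rw [Finset.sum_congr rfl h, sum_alternating_telescope
    (fun i => descentGF q n (alternatingSet (2 * i + 1) (2 * u + 1))),
    alternatingSet_eq_empty (by omega), descentGF_empty, oddSet_two_mul_add_one]

end Alternating

/-! ### Gaussian binomial coefficients count subspaces -/

section Gauss

theorem gaussBinom_one (n j : ℕ) : gaussBinom 1 n j = n.choose j := by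
  simp [gaussBinom]

theorem gaussBinom_eq_zero {q n j : ℕ} (h : n < j) : gaussBinom q n j = 0 := by
  rw [gaussBinom, Finset.powersetCard_eq_empty.2 (by simpa using h), Finset.sum_empty]

/-- The `q`-Pascal rule: the last element, if it lies in the subset, is larger than all `n - j`
elements of the complement. -/
theorem gaussBinom_succ (q n j : ℕ) :
    gaussBinom q (n + 1) (j + 1) = q ^ (n - j) * gaussBinom q n j + gaussBinom q n (j + 1) := by
  have hlast : ∀ B : Finset (Fin n), Fin.last n ∉ B.map Fin.castSuccEmb := by
    intro B h
    obtain ⟨x, -, hx⟩ := Finset.mem_map.1 h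
    exact (Fin.castSucc_lt_last x).ne hx
  have huniv : (Finset.univ : Finset (Fin (n + 1))) =
      insert (Fin.last n) (Finset.univ.map Fin.castSuccEmb) := by
    rw [Fin.univ_castSuccEmb, Finset.cons_eq_insert]
  have hcross : ∀ B C : Finset (Fin n), crossInv (B.map Fin.castSuccEmb) (C.map Fin.castSuccEmb) =
      crossInv B C := by
    intro B C
    simp only [crossInv, Finset.sum_map, Fin.coe_castSuccEmb, Fin.castSucc_lt_castSucc_iff]
  have h1 : ∀ B : Finset (Fin n), crossInv (B.map Fin.castSuccEmb) (B.map Fin.castSuccEmb)ᶜ =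
      crossInv B Bᶜ := by
    intro B
    have : (B.map Fin.castSuccEmb)ᶜ = insert (Fin.last n) (Bᶜ.map Fin.castSuccEmb) := by
      ext x
      refine Fin.lastCases ?_ (fun i => ?_) x <;> simp [Fin.castSucc_ne_last]
    rw [this, ← hcross, crossInv, crossInv]
    refine Finset.sum_congr rfl fun a ha => ?_
    rw [Finset.sum_insert (hlast _), if_neg (not_lt_of_ge (Fin.le_last a)), zero_add]
  have h2 : ∀ B : Finset (Fin n), crossInv (insert (Fin.last n) (B.map Fin.castSuccEmb))
      (insert (Fin.last n) (B.map Fin.castSuccEmb))ᶜ = (n - B.card) + crossInv B Bᶜ := by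
    intro B
    have : (insert (Fin.last n) (B.map Fin.castSuccEmb))ᶜ = Bᶜ.map Fin.castSuccEmb := by
      ext x
      refine Fin.lastCases ?_ (fun i => ?_) x <;> simp [Fin.castSucc_ne_last]
    rw [this, ← hcross, crossInv, Finset.sum_insert (hlast _), crossInv]
    congr 1
    rw [Finset.sum_map]
    simp [Fin.castSucc_lt_last, Finset.card_compl]
  rw [gaussBinom, huniv, Finset.powersetCard_succ_insert (hlast _), Finset.sum_union, add_comm]
  · congr 1
    · rw [Finset.sum_image, Finset.powersetCard_map, Finset.sum_map, gaussBinom, Finset.mul_sum]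
      · refine Finset.sum_congr rfl fun B hB => ?_
        rw [← pow_add, ← (Finset.mem_powersetCard.1 hB).2, ← h2]
        rfl
      · intro B hB C hC h
        have hB' : Fin.last n ∉ B := fun h => hlast _ ((Finset.mem_powersetCard.1 hB).1 h)
        have hC' : Fin.last n ∉ C := fun h => hlast _ ((Finset.mem_powersetCard.1 hC).1 h)
        rw [← Finset.erase_insert hB', ← Finset.erase_insert hC']
        exact congrArg (fun D => D.erase (Fin.last n)) h
    · rw [Finset.powersetCard_map, Finset.sum_map, gaussBinom]
      exact Finset.sum_congr rfl fun B _ => by rw [← h1]; rfl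
  · rw [Finset.disjoint_left]
    intro B hB hB'
    obtain ⟨C, -, rfl⟩ := Finset.mem_image.1 hB'
    exact hlast _ ((Finset.mem_powersetCard.1 hB).1 (Finset.mem_insert_self _ _))

/-- The product formula, multiplied out so that it holds for all `q`. -/
theorem gaussBinom_mul_prod (q n d : ℕ) :
    (gaussBinom q n d : ℤ) * ∏ i ∈ Finset.range d, ((q : ℤ) ^ d - q ^ i) =
      ∏ i ∈ Finset.range d, ((q : ℤ) ^ n - q ^ i) := by
  have hP : ∀ n d : ℕ, ∏ i ∈ Finset.range (d + 1), ((q : ℤ) ^ (n + 1) - q ^ i) =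
      (q ^ (n + 1) - 1) * q ^ d * ∏ i ∈ Finset.range d, ((q : ℤ) ^ n - q ^ i) := by
    intro n d
    rw [Finset.prod_range_succ', pow_zero, mul_comm, mul_assoc]
    congr 1
    have : ∀ i ∈ Finset.range d, (q : ℤ) ^ (n + 1) - q ^ (i + 1) = q * (q ^ n - q ^ i) :=
      fun i _ => by ring
    rw [Finset.prod_congr rfl this, Finset.prod_mul_distrib, Finset.prod_const, Finset.card_range]
  induction n generalizing d with
  | zero =>
    rcases d with _ | d
    · simp [gaussBinom_zero_right]
    · have h0 : ∏ i ∈ Finset.range (d + 1), ((q : ℤ) ^ 0 - q ^ i) = 0 :=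
        Finset.prod_eq_zero (Finset.mem_range.2 (Nat.succ_pos d)) (sub_self _)
      rw [gaussBinom_eq_zero (Nat.succ_pos d), h0]
      simp
  | succ n ih =>
    rcases d with _ | d
    · simp [gaussBinom_zero_right]
    have h1 := ih d
    have h2 := ih (d + 1)
    rw [hP, Finset.prod_range_succ] at h2
    rw [gaussBinom_succ, hP, hP]
    push_cast
    rcases lt_or_ge n d with hnd | hnd
    · have h0 : ∏ i ∈ Finset.range d, ((q : ℤ) ^ n - q ^ i) = 0 :=
        Finset.prod_eq_zero (Finset.mem_range.2 hnd) (sub_self _)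
      rw [h0, gaussBinom_eq_zero hnd, gaussBinom_eq_zero (hnd.trans (Nat.lt_succ_self d))]
      simp
    · have hq : (q : ℤ) ^ (n - d) * q ^ d = q ^ n := by rw [← pow_add, Nat.sub_add_cancel hnd]
      set P := ∏ i ∈ Finset.range d, ((q : ℤ) ^ n - q ^ i)
      set D := ∏ i ∈ Finset.range d, ((q : ℤ) ^ d - q ^ i)
      linear_combination (q : ℤ) ^ (n - d) * (q ^ (d + 1) - 1) * q ^ d * h1 + h2 +
        (q ^ (d + 1) - 1) * P * hq

variable {K V : Type*} [Field K] [Fintype K] [AddCommGroup V] [Module K V] [Finite V]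

/-- The number of subspaces of dimension `d`: every one of them is the span of equally many linearly
independent `d`-tuples. -/
theorem card_submodule_finrank_eq (d : ℕ) (hd : d ≤ Module.finrank K V) :
    Nat.card {W : Submodule K V // Module.finrank K W = d} =
      gaussBinom (Fintype.card K) (Module.finrank K V) d := by
  set q := Fintype.card K with hq
  set m := Module.finrank K V with hm
  have : Fintype {W : Submodule K V // Module.finrank K W = d} := Fintype.ofFinite _
  -- a linearly independent tuple is fibred over its span
  set f : {s : Fin d → V // LinearIndependent K s} →
      {W : Submodule K V // Module.finrank K W = d} :=
    fun s => ⟨Submodule.span K (Set.range s.1), by rw [finrank_span_eq_card s.2, Fintype.card_fin]⟩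
    with hf
  have hfib : ∀ W : {W : Submodule K V // Module.finrank K W = d},
      Nat.card {s // f s = W} = ∏ i : Fin d, (q ^ d - q ^ i.1) := by
    rintro ⟨W, hW⟩
    have h := card_linearIndependent (K := K) (V := W) (k := d) hW.ge
    rw [hW] at h
    rw [← h]
    refine Nat.card_congr
      { toFun := fun s => ⟨fun i => ⟨s.1.1 i, ?_⟩, LinearIndependent.of_comp W.subtype s.1.2⟩
        invFun := fun t => ⟨⟨fun i => (t.1 i : V), t.2.map' W.subtype W.ker_subtype⟩, ?_⟩
        left_inv := fun s => rfl
        right_inv := fun t => rfl }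
    · have h1 : Submodule.span K (Set.range s.1.1) = W := congrArg Subtype.val s.2
      refine h1.le ?_
      exact Submodule.subset_span (Set.mem_range_self i)
    · refine Subtype.ext (Submodule.eq_of_le_of_finrank_eq (Submodule.span_le.2 ?_) ?_)
      · rintro _ ⟨i, rfl⟩
        exact (t.1 i).2
      · exact (f _).2.trans hW.symm
  have hcard : Nat.card {s : Fin d → V // LinearIndependent K s} =
      Nat.card {W : Submodule K V // Module.finrank K W = d} * ∏ i : Fin d, (q ^ d - q ^ i.1) := by
    rw [← Nat.card_congr (Equiv.sigmaFiberEquiv f), Nat.card_sigma,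
      Finset.sum_congr rfl fun W _ => hfib W, Finset.sum_const, smul_eq_mul, Finset.card_univ,
      Nat.card_eq_fintype_card]
  rw [card_linearIndependent hd] at hcard
  have h1 := gaussBinom_mul_prod q m d
  have hq1 : 1 < q := Fintype.one_lt_card
  have hcast : ∀ e, d ≤ e → ((∏ i : Fin d, (q ^ e - q ^ i.1) : ℕ) : ℤ) =
      ∏ i ∈ Finset.range d, ((q : ℤ) ^ e - q ^ i) := by
    intro e he
    rw [Finset.prod_range, Nat.cast_prod]
    refine Finset.prod_congr rfl fun i _ => ?_
    rw [Nat.cast_sub (Nat.pow_le_pow_right hq1.le (i.2.le.trans he))]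
    push_cast
    rfl
  have h2 := congrArg (Nat.cast (R := ℤ)) hcard
  rw [hcast m hd, Nat.cast_mul, hcast d le_rfl, ← h1] at h2
  have hne : ∏ i ∈ Finset.range d, ((q : ℤ) ^ d - q ^ i) ≠ 0 := by
    refine Finset.prod_ne_zero_iff.2 fun i hi => sub_ne_zero.2 (ne_of_gt ?_)
    exact_mod_cast Nat.pow_lt_pow_right hq1 (Finset.mem_range.1 hi)
  exact_mod_cast (mul_right_cancel₀ hne h2).symm

end Gauss

/-! ### Matroids in which the number of flats of an interval depends only on ranks -/

section Uniform

variable {α : Type*} [Fintype α]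

/-- A matroid of rank `r` in which the interval above a flat of rank `k < r` has
`g (n - k) (j - k)` flats of rank `j`, for `k < j < r`. -/
structure HasUniformFlats (M : Matroid α) (r n : ℕ) (g : ℕ → ℕ → ℕ) : Prop where
  rank_ground : setRank M M.E = r
  card_flats : ∀ F, M.IsFlat F → setRank M F < r → ∀ j, setRank M F < j → j < r →
    Nat.card {G : Set α // M.IsFlat G ∧ F ⊆ G ∧ setRank M G = j} =
      g (n - setRank M F) (j - setRank M F)

variable {M : Matroid α} {r n : ℕ} {g : ℕ → ℕ → ℕ}

theorem HasUniformFlats.setRank_le (h : HasUniformFlats M r n g) {F : Set α} (hF : M.IsFlat F) :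
    setRank M F ≤ r := h.rank_ground ▸ setRank_mono hF.subset_ground

theorem HasUniformFlats.eq_ground (h : HasUniformFlats M r n g) {F : Set α} (hF : M.IsFlat F)
    (hr : setRank M F = r) : F = M.E := by
  by_contra hne
  have := setRank_lt_of_ssubset hF M.ground_isFlat (hF.subset_ground.ssubset_of_ne hne)
  rw [h.rank_ground, hr] at this
  exact lt_irrefl _ this

/-- Sums over the flats strictly above `F` of functions of the rank. The flats are indexed by a
finset `S` in a type `L` with an injection `e` into the sets, so that the formula applies to both
index types of variables. -/
theorem HasUniformFlats.sum_flats (h : HasUniformFlats M r n g) {F : Set α} (hF : M.IsFlat F)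
    {s : ℕ} (hs : r = setRank M F + s + 1) {L : Type*} {e : L → Set α} (he : Function.Injective e)
    (S : Finset L) (hS : ∀ G, (∃ x ∈ S, e x = G) ↔ M.IsFlat G ∧ F ⊂ G) (φ : ℕ → ℤ[X]) :
    ∑ x ∈ S, φ (setRank M (e x)) = ∑ j ∈ Finset.range s,
      (g (n - setRank M F) (j + 1) : ℤ[X]) * φ (setRank M F + (j + 1)) + φ r := by
  classical
  have hSe : ∀ x ∈ S, M.IsFlat (e x) ∧ F ⊂ e x := fun x hx => (hS _).1 ⟨x, hx, rfl⟩
  have hlt : ∀ x ∈ S, setRank M F < setRank M (e x) := fun x hx =>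
    setRank_lt_of_ssubset hF (hSe x hx).1 (hSe x hx).2
  have hmaps : ∀ x ∈ S, setRank M (e x) - (setRank M F + 1) ∈ Finset.range (s + 1) := by
    intro x hx
    have h1 := hlt x hx
    have h2 := h.setRank_le (hSe x hx).1
    rw [Finset.mem_range]
    omega
  have hfib : ∀ j, ∑ x ∈ S with setRank M (e x) - (setRank M F + 1) = j, φ (setRank M (e x)) =
      ((S.filter fun x => setRank M (e x) = setRank M F + (j + 1)).card : ℤ[X]) *
        φ (setRank M F + (j + 1)) := by
    intro j
    rw [← nsmul_eq_mul, ← Finset.sum_const]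
    refine Finset.sum_congr (Finset.filter_congr fun x hx => ?_) fun x hx => ?_
    · have h1 := hlt x hx
      omega
    · rw [(Finset.mem_filter.1 hx).2]
  rw [← Finset.sum_fiberwise_of_maps_to hmaps, Finset.sum_congr rfl fun j _ => hfib j,
    Finset.sum_range_succ]
  congr 1
  · refine Finset.sum_congr rfl fun j hj => ?_
    rw [Finset.mem_range] at hj
    have h1 := h.card_flats F hF (by omega) (setRank M F + (j + 1)) (by omega) (by omega)
    rw [Nat.add_sub_cancel_left] at h1
    rw [← h1, ← Nat.card_eq_finsetCard]
    congr 2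
    refine Nat.card_congr (Equiv.ofBijective (fun x => ⟨e x.1,
      (hSe _ (Finset.mem_filter.1 x.2).1).1, (hSe _ (Finset.mem_filter.1 x.2).1).2.subset,
      (Finset.mem_filter.1 x.2).2⟩) ⟨fun x y hxy => ?_, ?_⟩)
    · exact Subtype.ext (he (congrArg Subtype.val hxy))
    · rintro ⟨G, hG, hFG, hGr⟩
      obtain ⟨x, hx, rfl⟩ := (hS G).2 ⟨hG, hFG.ssubset_of_ne (by rintro rfl; omega)⟩
      exact ⟨⟨x, Finset.mem_filter.2 ⟨hx, hGr⟩⟩, rfl⟩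
  · have hFE : F ⊂ M.E := hF.subset_ground.ssubset_of_ne (by
      rintro rfl
      have := h.rank_ground
      omega)
    obtain ⟨x, hx, hxE⟩ := (hS M.E).2 ⟨M.ground_isFlat, hFE⟩
    have hone : (S.filter fun x => setRank M (e x) = setRank M F + (s + 1)) = {x} := by
      ext y
      rw [Finset.mem_filter, Finset.mem_singleton]
      constructor
      · rintro ⟨hy, hyr⟩
        exact he (hxE ▸ h.eq_ground (hSe y hy).1 (by omega))
      · rintro rfl
        exact ⟨hx, by rw [hxE, h.rank_ground]; omega⟩
    rw [hone, Finset.card_singleton, Nat.cast_one, one_mul, hs, add_assoc]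

/-- The recursion for `chowPoly` is the Feichtner--Yuzvinsky recursion with the flats grouped by
rank. -/
theorem HasUniformFlats.chowPoly_recursion (h : HasUniformFlats M r n g) {F : Set α}
    (hF : M.IsFlat F) {L : Type*} {e : L → Set α} (he : Function.Injective e) (S : Finset L)
    (hS : ∀ G, (∃ x ∈ S, e x = G) ↔ M.IsFlat G ∧ F ⊂ G) :
    chowPoly g (r - setRank M F) (n - setRank M F) =
      1 + ∑ x ∈ S, geomPoly (setRank M (e x) - setRank M F - 1) *
        chowPoly g (r - setRank M (e x)) (n - setRank M (e x)) := by
  rcases (h.setRank_le hF).eq_or_lt with hr | hlt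
  · have hSe : S = ∅ := by
      rw [Finset.eq_empty_iff_forall_notMem]
      intro x hx
      have h1 := (hS _).1 ⟨x, hx, rfl⟩
      exact h1.2.not_subset (h.eq_ground hF hr ▸ h1.1.subset_ground)
    rw [hSe, Finset.sum_empty, add_zero, hr, Nat.sub_self, chowPoly_zero]
  · obtain ⟨s, hs⟩ : ∃ s, r = setRank M F + s + 1 := ⟨r - setRank M F - 1, by omega⟩
    rw [h.sum_flats hF hs he S hS (fun j => geomPoly (j - setRank M F - 1) *
      chowPoly g (r - j) (n - j)), show r - setRank M F = s + 1 by omega, chowPoly_succ, add_assoc,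
      Nat.sub_self, chowPoly_zero, mul_one, show s + 1 - 1 = s by omega]
    congr 2
    refine Finset.sum_congr rfl fun j hj => ?_
    rw [show setRank M F + (j + 1) - setRank M F - 1 = j by omega,
      show r - (setRank M F + (j + 1)) = s - j by omega, Nat.sub_sub, mul_assoc]

theorem HasUniformFlats.hasHilb_chowIdeal [M.Loopless] (h : HasUniformFlats M r n g) :
    HasHilb (chowIdeal M) (chowPoly g r n) := by
  classical
  rw [chowIdeal_eq]
  have h1 := hasHilb_chainIdeal_univ (isRankFunction_nonemptyFlat (M := M))
    (fun F => setRank_pos_of_nonempty F.2.1 F.2.2) (fun F G => by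
      have := setRank_sup_add_le (M := M) (Set.empty_subset F.1) (Set.empty_subset G.1)
      exact (Nat.le_add_right _ _).trans this)
    (H := fun F => chowPoly g (r - setRank M F.1) (n - setRank M F.1))
    (fun F => h.chowPoly_recursion F.2.1 Subtype.val_injective _ (fun G => by
      simp only [Finset.mem_filter, Finset.mem_univ, true_and]
      constructor
      · rintro ⟨x, hx, rfl⟩
        exact ⟨x.2.1, hx⟩
      · rintro ⟨hG, hFG⟩
        exact ⟨⟨G, hG, F.2.2.mono hFG.subset⟩, hFG, rfl⟩))
  have h2 := h.chowPoly_recursion isFlat_empty (Subtype.val_injective (p := fun F : Set α =>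
    M.IsFlat F ∧ F.Nonempty)) Finset.univ (fun G => by
      simp only [Finset.mem_univ, true_and]
      constructor
      · rintro ⟨x, rfl⟩
        exact ⟨x.2.1, Set.empty_ssubset.2 x.2.2⟩
      · rintro ⟨hG, hFG⟩
        exact ⟨⟨G, hG, Set.empty_ssubset.1 hFG⟩, rfl⟩)
  simp only [setRank_empty, Nat.sub_zero] at h2
  rw [h2]
  exact h1

theorem HasUniformFlats.hasHilb_augChowIdeal [M.Loopless] (hr : 1 ≤ r)
    (h : HasUniformFlats M r n g) : HasHilb (augChowIdeal M) (augChowPoly g r n) := by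
  classical
  refine MatroidChow.hasHilb_augChowIdeal ?_
  have h1 := hasHilb_chainIdeal_univ (isRankFunction_flat (M := M)) (fun F => Nat.succ_pos _)
    (fun F G => by
      have := setRank_sup_add_le (M := M) (Set.empty_subset F.1) (Set.empty_subset G.1)
      change setRank M (M.closure (F.1 ∪ G.1)) + 1 ≤ _
      omega)
    (H := fun F => chowPoly g (r - setRank M F.1) (n - setRank M F.1))
    (fun F => by
      rw [h.chowPoly_recursion F.2 (Subtype.val_injective (p := fun F : Set α => M.IsFlat F))
        (Finset.univ.filter fun G => F < G) (fun G => by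
        simp only [Finset.mem_filter, Finset.mem_univ, true_and]
        constructor
        · rintro ⟨x, hx, rfl⟩
          exact ⟨x.2, hx⟩
        · rintro ⟨hG, hFG⟩
          exact ⟨⟨G, hG⟩, hFG, rfl⟩)]
      simp only [Nat.add_sub_add_right])
  convert h1 using 1
  obtain ⟨s, rfl⟩ : ∃ s, r = s + 1 := ⟨r - 1, by omega⟩
  rw [← Finset.add_sum_erase _ _ (Finset.mem_univ (⟨∅, isFlat_empty⟩ : Flat M))]
  have h0 : geomPoly (setRank M (∅ : Set α) + 1 - 1) = 0 := by simp [setRank_empty, geomPoly]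
  rw [h0, zero_mul, zero_add, augChowPoly, add_assoc]
  congr 1
  simp only [Nat.add_sub_cancel]
  have h3 := h.sum_flats (F := ∅) isFlat_empty (s := s) (by rw [setRank_empty, zero_add])
    (Subtype.val_injective (p := fun F : Set α => M.IsFlat F))
    (Finset.univ.erase (⟨∅, isFlat_empty⟩ : Flat M)) (fun G => by
      simp only [Finset.mem_erase, Finset.mem_univ, and_true]
      constructor
      · rintro ⟨x, hx, rfl⟩
        refine ⟨x.2, Set.empty_ssubset.2 (Set.nonempty_iff_ne_empty.2 fun h => hx (Subtype.ext h))⟩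
      · rintro ⟨hG, hFG⟩
        refine ⟨⟨G, hG⟩, fun h => ?_, rfl⟩
        exact (Set.empty_ssubset.1 hFG).ne_empty (congrArg Subtype.val h))
    (fun j => geomPoly j * chowPoly g (s + 1 - j) (n - j))
  rw [h3, Nat.sub_self, chowPoly_zero, mul_one]
  simp only [setRank_empty, Nat.sub_zero, zero_add, mul_assoc]

end Uniform

/-! ### Flats of the uniform and `q`-uniform matroids -/

section Matroids

theorem setRank_eq {α : Type*} [Finite α] {M : Matroid α} {X : Set α} {k : ℕ}
    (h1 : ∃ I ⊆ X, M.Indep I ∧ I.ncard = k) (h2 : ∀ I ⊆ X, M.Indep I → I.ncard ≤ k) :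
    setRank M X = k := by
  have : M.eRk X = k := by
    apply le_antisymm
    · rw [Matroid.eRk_le_iff]
      intro I hIX hI
      rw [← (Set.toFinite I).cast_ncard_eq]
      exact_mod_cast h2 I hIX hI
    · rw [Matroid.le_eRk_iff]
      obtain ⟨I, hIX, hI, rfl⟩ := h1
      exact ⟨I, hIX, hI, ((Set.toFinite I).cast_ncard_eq).symm⟩
  rw [setRank, this]
  rfl

variable {r n : ℕ}

theorem setRank_uniformMatroid (F : Set (Fin n)) :
    setRank (uniformMatroid r n) F = min F.ncard r := by
  refine setRank_eq ?_ fun I hIF hI =>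
    le_min (Set.ncard_le_ncard hIF F.toFinite) ((uniformMatroid_indep_iff _ _ _).1 hI)
  obtain ⟨I, hIF, hI⟩ := Set.exists_subset_card_eq (min_le_left F.ncard r)
  exact ⟨I, hIF, (uniformMatroid_indep_iff _ _ _).2 (hI ▸ min_le_right _ _), hI⟩

theorem loopless_of_indep {α : Type*} {M : Matroid α} (h : ∀ e ∈ M.E, M.Indep {e}) :
    M.Loopless := by
  rw [Matroid.loopless_iff_forall_isNonloop]
  intro e he
  exact Matroid.indep_singleton.1 (h e he)

theorem loopless_uniformMatroid (hr : 1 ≤ r) : (uniformMatroid r n).Loopless :=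
  loopless_of_indep fun e _ => (uniformMatroid_indep_iff _ _ _).2 (by simpa using hr)

theorem card_set_ncard_eq (F : Set (Fin n)) (j : ℕ) (hj : F.ncard ≤ j) :
    Nat.card {G : Set (Fin n) // F ⊆ G ∧ G.ncard = j} = (n - F.ncard).choose (j - F.ncard) := by
  classical
  have hcompl : Fᶜ.toFinset.card = n - F.ncard := by
    rw [← Set.ncard_eq_toFinset_card', Set.ncard_compl, Nat.card_eq_fintype_card, Fintype.card_fin]
  rw [← hcompl, ← Finset.card_powersetCard, ← Nat.card_eq_finsetCard]
  refine Nat.card_congr (Equiv.ofBijective (fun G => ⟨(G.1 \ F).toFinset, ?_⟩) ⟨?_, ?_⟩)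
  · rw [Finset.mem_powersetCard]
    constructor
    · intro x
      simp
    · rw [← Set.ncard_eq_toFinset_card', Set.ncard_sdiff G.2.1, G.2.2]
  · rintro ⟨G, hG, hGj⟩ ⟨G', hG', hGj'⟩ h
    have h1 : G \ F = G' \ F := Set.toFinset_inj.1 (congrArg Subtype.val h)
    refine Subtype.ext (?_ : G = G')
    rw [← Set.sdiff_union_of_subset hG, h1, Set.sdiff_union_of_subset hG']
  · rintro ⟨B, hB⟩
    rw [Finset.mem_powersetCard] at hB
    have hdisj : Disjoint (B : Set (Fin n)) F := by
      rw [Set.disjoint_left]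
      intro x hx
      simpa using hB.1 hx
    refine ⟨⟨B ∪ F, Set.subset_union_right, ?_⟩, ?_⟩
    · rw [Set.ncard_union_eq hdisj, Set.ncard_coe_finset, hB.2]
      omega
    · refine Subtype.ext ?_
      ext x
      simp only [Set.mem_toFinset, Set.mem_sdiff, Set.mem_union, Finset.mem_coe]
      constructor
      · rintro ⟨h | h, h'⟩
        exacts [h, absurd h h']
      · exact fun h => ⟨Or.inl h, Set.disjoint_left.1 hdisj h⟩

theorem hasUniformFlats_uniformMatroid (hrn : r ≤ n) :
    HasUniformFlats (uniformMatroid r n) r n (gaussBinom 1) where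
  rank_ground := by
    rw [setRank_uniformMatroid]
    change min (Set.univ : Set (Fin n)).ncard r = r
    simpa using hrn
  card_flats F hF hFr j hFj hjr := by
    rw [setRank_uniformMatroid] at hFr hFj
    have hF' : setRank (uniformMatroid r n) F = F.ncard := by
      rw [setRank_uniformMatroid]; omega
    rw [hF', gaussBinom_one, ← card_set_ncard_eq F j (by omega)]
    refine Nat.card_congr (Equiv.subtypeEquivRight fun G => ?_)
    rw [setRank_uniformMatroid, uniformMatroid_isFlat_iff]
    constructor
    · rintro ⟨-, h1, h2⟩
      exact ⟨h1, by omega⟩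
    · rintro ⟨h1, h2⟩
      exact ⟨Or.inl (by omega), h1, by omega⟩

variable {K : Type*} [Field K]

/-- The subspaces that contain `W` correspond to the subspaces of `V ⧸ W`. -/
theorem card_submodule_ge_finrank_eq {V : Type*} [AddCommGroup V] [Module K V] [Finite V]
    [Fintype K] (W : Submodule K V) (j : ℕ) (h1 : Module.finrank K W ≤ j)
    (h2 : j ≤ Module.finrank K V) :
    Nat.card {U : Submodule K V // W ≤ U ∧ Module.finrank K U = j} =
      gaussBinom (Fintype.card K) (Module.finrank K V - Module.finrank K W)
        (j - Module.finrank K W) := by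
  have hq : Module.finrank K (V ⧸ W) = Module.finrank K V - Module.finrank K W := by
    have := W.finrank_quotient_add_finrank
    omega
  have hmap : ∀ U : Submodule K V, W ≤ U →
      Module.finrank K (U.map W.mkQ) + Module.finrank K W = Module.finrank K U := by
    intro U hU
    have h3 := W.finrank_quotient_add_finrank
    have h4 := U.finrank_quotient_add_finrank
    have h5 := (U.map W.mkQ).finrank_quotient_add_finrank
    rw [(Submodule.quotientQuotientEquivQuotient W U hU).finrank_eq] at h5
    omega
  have : Finite (V ⧸ W) := Finite.of_surjective _ W.mkQ_surjective
  rw [← hq, ← card_submodule_finrank_eq _ (by omega)]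
  refine Nat.card_congr (Equiv.ofBijective (fun U => ⟨U.1.map W.mkQ, ?_⟩) ⟨?_, ?_⟩)
  · have := hmap U.1 U.2.1
    rw [U.2.2] at this
    omega
  · rintro ⟨U, hU, hUj⟩ ⟨U', hU', hUj'⟩ h
    have h1 : U.map W.mkQ = U'.map W.mkQ := congrArg Subtype.val h
    have h2 := congrArg (Submodule.comap W.mkQ) h1
    rw [Submodule.comap_map_mkQ, Submodule.comap_map_mkQ, sup_eq_right.2 hU,
      sup_eq_right.2 hU'] at h2
    exact Subtype.ext h2
  · rintro ⟨T, hT⟩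
    have hWT : W ≤ T.comap W.mkQ := by
      intro w hw
      rw [Submodule.mem_comap, Submodule.mkQ_apply, (Submodule.Quotient.mk_eq_zero W).2 hw]
      exact T.zero_mem
    have hTT : (T.comap W.mkQ).map W.mkQ = T :=
      Submodule.map_comap_eq_of_surjective W.mkQ_surjective T
    have h3 := hmap _ hWT
    rw [hTT, hT] at h3
    exact ⟨⟨T.comap W.mkQ, hWT, by omega⟩, Subtype.ext hTT⟩

variable [Finite K]

theorem setRank_qUniformMatroid (V : Submodule K (Fin n → K)) :
    setRank (qUniformMatroid r n K) {v | v ∈ V ∧ v ≠ 0} = min (Module.finrank K V) r := by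
  refine setRank_eq ?_ fun I hIF hI => ?_
  · set b := Module.finBasis K V
    have hli : LinearIndependent K fun i => (b i : Fin n → K) :=
      b.linearIndependent.map' V.subtype V.ker_subtype
    have hcard : (Set.range fun i => (b i : Fin n → K)).ncard = Module.finrank K V := by
      rw [← finrank_span_eq_ncard _ hli.linearIndepOn_id, finrank_span_eq_card hli,
        Fintype.card_fin]
    obtain ⟨I, hIb, hI⟩ := Set.exists_subset_card_eq
      (n := min (Module.finrank K V) r) ((min_le_left _ r).trans_eq hcard.symm)
    have hIli : LinearIndepOn K id I := hli.linearIndepOn_id.mono hIb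
    refine ⟨I, fun v hv => ⟨?_, fun h0 => hIli.ne_zero hv h0⟩,
      (qUniformMatroid_indep_iff _ _ _ _).2 ⟨hIli, hI ▸ min_le_right _ _⟩, hI⟩
    obtain ⟨i, rfl⟩ := hIb hv
    exact (b i).2
  · have hI' := (qUniformMatroid_indep_iff _ _ _ _).1 hI
    refine le_min ?_ hI'.2
    rw [← finrank_span_eq_ncard I hI'.1]
    exact Submodule.finrank_mono (Submodule.span_le.2 fun v hv => (hIF hv).1)

theorem loopless_qUniformMatroid (hr : 1 ≤ r) : (qUniformMatroid r n K).Loopless :=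
  loopless_of_indep fun e he => (qUniformMatroid_indep_iff _ _ _ _).2
    ⟨(linearIndepOn_singleton_iff K).2 he, by simpa using hr⟩

theorem hasUniformFlats_qUniformMatroid [Fintype K] (hrn : r ≤ n) :
    HasUniformFlats (qUniformMatroid r n K) r n (gaussBinom (Fintype.card K)) where
  rank_ground := by
    have := setRank_qUniformMatroid (r := r) (⊤ : Submodule K (Fin n → K))
    simp only [Submodule.mem_top, true_and, finrank_top, Module.finrank_fin_fun] at this
    rw [min_eq_right hrn] at this
    exact this
  card_flats F hF hFr j hFj hjr := by
    obtain ⟨W, hW, rfl⟩ := (qUniformMatroid_isFlat_iff _ _ _ _).1 hF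
    rw [setRank_qUniformMatroid] at hFr hFj ⊢
    have hmin : min (Module.finrank K W) r = Module.finrank K W := by omega
    rw [hmin] at hFr hFj ⊢
    have hle : ∀ U U' : Submodule K (Fin n → K),
        {v | v ∈ U ∧ v ≠ 0} ⊆ {v | v ∈ U' ∧ v ≠ 0} ↔ U ≤ U' := by
      intro U U'
      constructor
      · intro h v hv
        by_cases h0 : v = 0
        · exact h0 ▸ U'.zero_mem
        · exact (h ⟨hv, h0⟩).1
      · exact fun h v hv => ⟨h hv.1, hv.2⟩
    have h1 := card_submodule_ge_finrank_eq W j (by omega) (by rw [Module.finrank_fin_fun]; omega)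
    rw [Module.finrank_fin_fun] at h1
    rw [← h1]
    symm
    refine Nat.card_congr (Equiv.ofBijective (fun U => ⟨{v | v ∈ U.1 ∧ v ≠ 0}, ?_, ?_, ?_⟩)
      ⟨?_, ?_⟩)
    · exact (qUniformMatroid_isFlat_iff _ _ _ _).2 ⟨U.1, Or.inl (by rw [U.2.2]; exact hjr), rfl⟩
    · exact (hle _ _).2 U.2.1
    · rw [setRank_qUniformMatroid, U.2.2]; omega
    · intro U U' h
      have h2 := congrArg Subtype.val h
      exact Subtype.ext (le_antisymm ((hle _ _).1 h2.subset) ((hle _ _).1 h2.symm.subset))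
    · rintro ⟨G, hG, hFG, hGj⟩
      obtain ⟨U, hU, rfl⟩ := (qUniformMatroid_isFlat_iff _ _ _ _).1 hG
      rw [setRank_qUniformMatroid] at hGj
      exact ⟨⟨U, (hle _ _).1 hFG, by omega⟩, rfl⟩

end Matroids

/-! ### Values at `-1` and Charney--Davis quantities -/

section CharneyDavis

/-- The generating polynomial by inversions of the permutations with descent set `S`. -/
def descentPoly (n : ℕ) (S : Finset ℕ) : ℕ[X] :=
  ∑ σ : Equiv.Perm (Fin n) with descentSet σ = S, X ^ inversionNumber σ

theorem eval_descentPoly (q n : ℕ) (S : Finset ℕ) :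
    (((descentPoly n S).eval q : ℕ) : ℤ) = descentGF q n S := by
  rw [descentPoly, descentGF, eval_finsetSum]
  push_cast
  exact Finset.sum_congr rfl fun σ _ => by rw [eval_pow, eval_X, Nat.cast_pow]

theorem charneyDavis_of_natDegree_eq {H : ℤ[X]} {u : ℕ} {c : ℤ} (hd : H.natDegree = 2 * u)
    (hH : H.eval (-1) = (-1) ^ u * c) : charneyDavis H = c := by
  rw [charneyDavis, hd, if_pos (even_two_mul u), hH, Nat.mul_div_cancel_left u two_pos, ← mul_assoc,
    ← pow_add, ← two_mul, pow_mul]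
  simp

theorem charneyDavis_of_eval_eq_zero {H : ℤ[X]} (hH : H.eval (-1) = 0) : charneyDavis H = 0 := by
  rw [charneyDavis, hH, mul_zero, ite_self]

/-- All numerical claims at once. The Hilbert polynomials have degrees `r - 1` and `r`, so the sign
in the Charney--Davis quantity cancels that of the value at `-1`. -/
theorem chow_evaluations (q : ℕ) {r n : ℕ} (hr : 1 ≤ r) (hrn : r ≤ n) :
    (Even r → (chowPoly (gaussBinom q) r n).eval (-1) = 0) ∧
    (Odd r → (chowPoly (gaussBinom q) r n).eval (-1) =
      (-1) ^ ((r - 1) / 2) * descentGF q n (evenSet (r - 1))) ∧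
    (Even r → (augChowPoly (gaussBinom q) r n).eval (-1) =
      (-1) ^ (r / 2) * descentGF q n (oddSet (r - 1))) ∧
    (Odd r → (augChowPoly (gaussBinom q) r n).eval (-1) = 0) ∧
    charneyDavis (chowPoly (gaussBinom q) r n) =
      (((if Odd r then descentPoly n (evenSet (r - 1)) else 0).eval q : ℕ) : ℤ) ∧
    charneyDavis (augChowPoly (gaussBinom q) r n) =
      (((if Even r then descentPoly n (oddSet (r - 1)) else 0).eval q : ℕ) : ℤ) := by
  have hc := eval_chowPoly (g := gaussBinom q) (A := fun m n => descentGF q n (evenSet m))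
    (gaussBinom_zero_right q) (fun u n hn => sum_gaussBinom_evenSet q hn) r n hrn
  have ha := eval_augChowPoly (g := gaussBinom q) (A := fun m n => descentGF q n (evenSet m))
    (B := fun m n => descentGF q n (oddSet m))
    (gaussBinom_zero_right q) (fun u n hn => sum_gaussBinom_evenSet q hn)
    (fun u n hn => sum_gaussBinom_oddSet q hn) r n hrn
  obtain ⟨s, rfl⟩ : ∃ s, r = s + 1 := ⟨r - 1, by omega⟩
  rcases Nat.even_or_odd' s with ⟨u, rfl | rfl⟩
  · have hodd : Odd (2 * u + 1) := odd_two_mul_add_one u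
    have heven : ¬ Even (2 * u + 1) := Nat.not_even_iff_odd.2 hodd
    have hc' := hc.2 u rfl
    have ha' := ha.2 u rfl
    refine ⟨fun h => absurd h heven, fun _ => ?_, fun h => absurd h heven, fun _ => ha', ?_, ?_⟩
    · rw [hc', Nat.add_sub_cancel, Nat.mul_div_cancel_left u two_pos]
    · rw [if_pos hodd, Nat.add_sub_cancel, eval_descentPoly]
      exact charneyDavis_of_natDegree_eq (natDegree_chowPoly _ _ _) hc'
    · rw [if_neg heven, charneyDavis_of_eval_eq_zero ha', eval_zero, Nat.cast_zero]
  · have heven : Even (2 * u + 1 + 1) := ⟨u + 1, by ring⟩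
    have hodd : ¬ Odd (2 * u + 1 + 1) := Nat.not_odd_iff_even.2 heven
    have hc' := hc.1 u rfl
    have ha' := ha.1 u rfl
    refine ⟨fun _ => hc', fun h => absurd h hodd, fun _ => ?_, fun h => absurd h hodd, ?_, ?_⟩
    · rw [ha', Nat.add_sub_cancel, show (2 * u + 1 + 1) / 2 = u + 1 by omega]
    · rw [if_neg hodd, charneyDavis_of_eval_eq_zero hc', eval_zero, Nat.cast_zero]
    · rw [if_pos heven, Nat.add_sub_cancel, eval_descentPoly]
      exact charneyDavis_of_natDegree_eq (u := u + 1) (natDegree_augChowPoly _ _ _) ha'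

end CharneyDavis

end MatroidChow

end

theorem theorem5p3 (n r : ℕ) (hr : 1 ≤ r) (hrn : r ≤ n) :
    ∃ P Q : ℕ[X],
      -- the case of a prime power `q`, the number of elements of a finite field `K`
      (∀ (K : Type*) [Field K] [Fintype K],
        ∃ H G : ℤ[X],
          (H : PowerSeries ℤ) = hilbertSeries (chowComponent (qUniformMatroid r n K)) ∧
          (G : PowerSeries ℤ) = hilbertSeries (augChowComponent (qUniformMatroid r n K)) ∧
          (Even r → H.eval (-1) = 0) ∧
          (Odd r → H.eval (-1) = (-1) ^ ((r - 1) / 2) *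
            ∑ σ : Equiv.Perm (Fin n) with descentSet σ = evenSet (r - 1),
              (Fintype.card K : ℤ) ^ inversionNumber σ) ∧
          (Even r → G.eval (-1) = (-1) ^ (r / 2) *
            ∑ σ : Equiv.Perm (Fin n) with descentSet σ = oddSet (r - 1),
              (Fintype.card K : ℤ) ^ inversionNumber σ) ∧
          (Odd r → G.eval (-1) = 0) ∧
          charneyDavis H = ((P.eval (Fintype.card K) : ℕ) : ℤ) ∧
          charneyDavis G = ((Q.eval (Fintype.card K) : ℕ) : ℤ)) ∧
      -- the case `q = 1`, where the matroid is the uniform matroid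
      (∃ H G : ℤ[X],
          (H : PowerSeries ℤ) = hilbertSeries (chowComponent (uniformMatroid r n)) ∧
          (G : PowerSeries ℤ) = hilbertSeries (augChowComponent (uniformMatroid r n)) ∧
          (Even r → H.eval (-1) = 0) ∧
          (Odd r → H.eval (-1) = (-1) ^ ((r - 1) / 2) *
            ∑ σ : Equiv.Perm (Fin n) with descentSet σ = evenSet (r - 1),
              (1 : ℤ) ^ inversionNumber σ) ∧
          (Even r → G.eval (-1) = (-1) ^ (r / 2) *
            ∑ σ : Equiv.Perm (Fin n) with descentSet σ = oddSet (r - 1),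
              (1 : ℤ) ^ inversionNumber σ) ∧
          (Odd r → G.eval (-1) = 0) ∧
          charneyDavis H = ((P.eval 1 : ℕ) : ℤ) ∧
          charneyDavis G = ((Q.eval 1 : ℕ) : ℤ)) := by
  refine ⟨if Odd r then descentPoly n (evenSet (r - 1)) else 0,
    if Even r then descentPoly n (oddSet (r - 1)) else 0, fun K _ _ => ?_, ?_⟩
  · have := loopless_qUniformMatroid (n := n) (K := K) hr
    have h := hasUniformFlats_qUniformMatroid (K := K) hrn
    exact ⟨_, _, hilbertSeries_chow_eq h.hasHilb_chowIdeal,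
      hilbertSeries_augChow_eq (h.hasHilb_augChowIdeal hr),
      chow_evaluations (Fintype.card K) hr hrn⟩
  · have := loopless_uniformMatroid (n := n) hr
    have h := hasUniformFlats_uniformMatroid hrn
    refine ⟨_, _, hilbertSeries_chow_eq h.hasHilb_chowIdeal,
      hilbertSeries_augChow_eq (h.hasHilb_augChowIdeal hr), ?_⟩
    have h1 := chow_evaluations 1 hr hrn
    simp only [descentGF, Nat.cast_one] at h1
    exact h1
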